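/- \textbf{Model.} A deterministic MPC program has $M$ machines, each with a local memory of $S$ words, and runs in synchronous rounds; in a round every machine performs arbitrary deterministic local computation and exchanges messages with the other machines, sending at most $S$ and receiving at most $S$ words. On an $n$-node graph with $m$ edges a word is a non-negative integer smaller than $n^{O(1)}$, and the nodes have the identifiers $0,\dots,n-1$. Initially the edges are distributed arbitrarily over the machines, each edge on exactly one machine and at most $\lceil n^{\alpha}\rceil$ edges per machine, where $M\lceil n^\alpha\rceil\ge n+m$. At the end, the memories of the machines together hold exactly the identifiers of the computed set of nodes. Logarithms are to base $2$. \textbf{Lemma (sparsification).} Let $0<\alpha<1$ and $c>0$ be constants. There are a constant $C>0$ and a deterministic MPC algorithm (both depending only on $\alpha$ and $c$; the algorithm is given $n$, $m$, $\Delta$ and $f$) with the following property. Let $n\ge 2$, let $\Delta\in\mathbb N$ and $f\in\mathbb R$ satisfy $$(\log n)^{c}\;\le\; f\;\le\;\frac{\Delta^{0.4}}{\log n},$$ and let $G$ be a graph with $n$ nodes, $m$ edges and bipartition $V(G)=U\sqcup V$ (each edge is given as a pair $(u,v)$ with $u\in U$, $v\in V$) such that $$\frac{\Delta}{f}\le \deg_G(u)\le\Delta\qquad\text{for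 every }u\in U .$$ Then the algorithm computes on $G$ a set $V^{sub}\subseteq V$ such that $$1\;\le\;|N_G(u)\cap V^{sub}|\;\le\;2^{C\log f}\qquad\text{for every }u\in U,$$ in at most $C\max\{1,\log\log\Delta\}$ rounds, with strongly sublinear local memory $S\le C n^{\alpha}$ and linear global space $M\cdot S\le C(n+m)$ (in words, with words smaller than $n^{C}$). -/

import Mathlib

/-- A deterministic program in the model of Massively Parallel Computation.  There are `machines`
machines, each with a local memory of `memory` words; a word is a natural number smaller than
`wordBound`.  The computation proceeds in `rounds` synchronous rounds.  In round `t`, machine `i`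
with memory content `x` sends to every machine `j` the (possibly empty) list of words
`send t i x j`; afterwards, a machine `i` with memory content `x` that has received the list
`inbox j` from every machine `j` replaces its memory content by `receive t i x inbox`.
Local computation is arbitrary, hence `send` and `receive` are arbitrary functions. -/
structure MPCProgram where
  machines : ℕ
  memory : ℕ
  wordBound : ℕ
  rounds : ℕ
  send : ℕ → Fin machines → List ℕ → Fin machines → List ℕ
  receive : ℕ → Fin machines → List ℕ → (Fin machines → List ℕ) → List ℕ

namespace MPCProgram

/-- The memory contents of all the machines after `t` rounds, from the initial contents `x₀`. -/
def state (P : MPCProgram) (x₀ : Fin P.machines → List ℕ) : ℕ → Fin P.machines → List ℕ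
  | 0 => x₀
  | t + 1 => fun i =>
      P.receive t i (P.state x₀ t i) (fun j => P.send t j (P.state x₀ t j) i)

/-- The words sent by machine `i` to machine `j` in round `t`. -/
def message (P : MPCProgram) (x₀ : Fin P.machines → List ℕ) (t : ℕ) (i j : Fin P.machines) :
    List ℕ :=
  P.send t i (P.state x₀ t i) j

/-- The memory contents of all the machines at the end of the computation. -/
def final (P : MPCProgram) (x₀ : Fin P.machines → List ℕ) : Fin P.machines → List ℕ :=
  P.state x₀ P.rounds

/-- On the initial contents `x₀`, the program respects the limits of the model: at all times every
machine stores at most `P.memory` words, in every round every machine sends at most `P.memory`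
words and receives at most `P.memory` words, and all words are smaller than `P.wordBound`. -/
structure RespectsLimits (P : MPCProgram) (x₀ : Fin P.machines → List ℕ) : Prop where
  stored : ∀ t ≤ P.rounds, ∀ i, (P.state x₀ t i).length ≤ P.memory
  sent : ∀ t < P.rounds, ∀ i, ∑ j, (P.message x₀ t i j).length ≤ P.memory
  received : ∀ t < P.rounds, ∀ i, ∑ j, (P.message x₀ t j i).length ≤ P.memory
  stored_word : ∀ t ≤ P.rounds, ∀ i, ∀ w ∈ P.state x₀ t i, w < P.wordBound
  sent_word : ∀ t < P.rounds, ∀ i j, ∀ w ∈ P.message x₀ t i j, w < P.wordBound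

end MPCProgram

/-- `E` distributes the edges of the graph `G`, whose nodes have the identifiers `0, …, n - 1` and
whose edges all have exactly one endpoint in `U`, over `M` machines: every edge is written as
`(u, v)` with `u ∈ U`, and occurs exactly once on exactly one machine; every machine holds at most
`L` edges. -/
structure IsEdgeDistribution {n : ℕ} (G : SimpleGraph (Fin n)) (U : Finset (Fin n)) (M L : ℕ)
    (E : Fin M → List (Fin n × Fin n)) : Prop where
  mem_iff : ∀ u v, (∃ i, (u, v) ∈ E i) ↔ u ∈ U ∧ G.Adj u v
  once : ∀ e, ∑ i, (E i).count e ≤ 1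
  load : ∀ i, (E i).length ≤ L

/-- A list of edges as a list of words, two words (the identifiers of the endpoints) per edge. -/
def edgeWords {n : ℕ} (l : List (Fin n × Fin n)) : List ℕ :=
  l.flatMap fun e => [(e.1 : ℕ), (e.2 : ℕ)]

/-! The degrees in U must drop from [Δ/f, Δ] to a power of f without reaching zero. A constant
number D = `depth α` of sampling stages suffices, so the allowance of log log Δ rounds is not
needed. One stage with probability p = `prob α n Δ f` moves a degree d into [pd/8, 4pd]. Since p ^ D
is proportional to λf/Δ, where λ = `deviation α n` = O(log n), the final degrees lie between 16λ and
16·32^D·λf. The hypothesis (log n)^c ≤ f turns this upper bound into a power of f.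

The sampling is derandomized by a family of T = `base α n ^ depth α` sets, polynomially many, such
that every subset of `range n` is badly sampled by fewer than n members (`exists_sampling_family`: a
Chernoff bound and an exponential potential). The family depends on the parameters only, so it is
known to every machine for free.

In each stage the edges are sorted by their endpoint in U. A neighbourhood is then cut into pieces,
each held by one machine, and all but at most two nonempty pieces fill a machine
(`IsSorted.pieces`). Summed over the family, the number of badly sampled pieces is at most n³ < T,
so some member is bad for no piece. It is found by conditional expectations, one digit of its index
at a time (`select_triple`). Full pieces are large enough to concentrate; the two partial ones cost
an additive 2λ (`IsSorted.degree_bounds`).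

Sorting and selection both rest on sums of short vectors over b^D machines, computed in D rounds of
exchange (`scan_triple`).

If n is bounded, or Δ is below a constant times λf, the graph itself already has suitable degrees
and nothing is sampled. -/

namespace MPC
open Finset

/-! ### Encoding of local states as lists of words -/

/-- A token `(position, u, v)` as a single word. -/
def code (x : ℕ × ℕ × ℕ) : ℕ := Nat.pair x.1 (Nat.pair x.2.1 x.2.2)

/-- The token of a word. -/
def decode (w : ℕ) : ℕ × ℕ × ℕ := ((Nat.unpair w).1, Nat.unpair (Nat.unpair w).2)

@[simp] theorem decode_code (x : ℕ × ℕ × ℕ) : decode (code x) = x := by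
  simp [decode, code]

theorem code_injective : Function.Injective code :=
  Function.LeftInverse.injective decode_code

theorem code_lt {Q : ℕ} {x : ℕ × ℕ × ℕ} (h₁ : x.1 < Q ^ 2) (h₂ : x.2.1 < Q) (h₃ : x.2.2 < Q) :
    code x < Q ^ 4 := by
  have h : Nat.pair x.2.1 x.2.2 < Q ^ 2 :=
    (Nat.pair_lt_max_add_one_sq _ _).trans_le (Nat.pow_le_pow_left (max_lt h₂ h₃) 2)
  calc code x < (max x.1 (Nat.pair x.2.1 x.2.2) + 1) ^ 2 := Nat.pair_lt_max_add_one_sq _ _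
    _ ≤ (Q ^ 2) ^ 2 := Nat.pow_le_pow_left (max_lt h₁ h) 2
    _ = Q ^ 4 := by ring

/-- The memory content of a machine: a set of tokens `(position, u, v)`, two vectors that serve
to compute sums over the machines, and a counter. -/
@[ext] structure LocalState (B : ℕ) where
  toks : Finset (ℕ × ℕ × ℕ)
  pre : Fin B → ℕ
  tot : Fin B → ℕ
  ctr : ℕ

/-- Needed for `Function.invFun` in `ofWords`. -/
instance (B : ℕ) : Nonempty (LocalState B) := ⟨⟨∅, 0, 0, 0⟩⟩

variable {B M : ℕ}

/-- A local state as a list of words. -/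
noncomputable def words (s : LocalState B) : List ℕ :=
  s.ctr :: (List.ofFn s.pre ++ (List.ofFn s.tot ++ s.toks.toList.map code))

/-- The counter and the two vectors fill a prefix of the fixed length 1 + 2B, so the list can be cut
in only one way; the order in which the tokens are listed is irrelevant. -/
theorem words_injective : Function.Injective (words (B := B)) := by
  intro s s' h
  simp only [words, List.cons.injEq] at h
  obtain ⟨h₁, h₂⟩ := h
  obtain ⟨h₂, h₃⟩ := List.append_inj h₂ (by simp)
  obtain ⟨h₃, h₄⟩ := List.append_inj h₃ (by simp)
  have h₅ := congrArg List.toFinset (List.map_injective_iff.2 code_injective h₄)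
  simp only [toList_toFinset] at h₅
  ext1
  exacts [h₅, List.ofFn_injective h₂, List.ofFn_injective h₃, h₁]

/-- The local state that is stored as a given list of words. -/
noncomputable def ofWords (l : List ℕ) : LocalState B := Function.invFun words l

@[simp] theorem ofWords_words (s : LocalState B) : ofWords (words s) = s :=
  Function.leftInverse_invFun words_injective s

/-! ### Sequences of rounds and a Hoare calculus for them -/

/-- One round of communication of `M` machines. -/
structure Round (M B : ℕ) where
  send : Fin M → LocalState B → Fin M → List ℕ
  recv : Fin M → LocalState B → (Fin M → List ℕ) → LocalState B

/-- The local states after a round. -/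
def Round.step (R : Round M B) (X : Fin M → LocalState B) (i : Fin M) : LocalState B :=
  R.recv i (X i) fun j => R.send j (X j) i

/-- The messages of a round respect the limits. -/
structure Round.Ok (S W : ℕ) (R : Round M B) (X : Fin M → LocalState B) : Prop where
  sent : ∀ i, ∑ j, (R.send i (X i) j).length ≤ S
  received : ∀ i, ∑ j, (R.send j (X j) i).length ≤ S
  word : ∀ i j, ∀ w ∈ R.send i (X i) j, w < W

/-- A local state respects the limits. -/
def Fits (S W : ℕ) (s : LocalState B) : Prop :=
  (words s).length ≤ S ∧ ∀ w ∈ words s, w < W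

theorem Fits.of_bounds {S W L : ℕ} {s : LocalState B} (hS : 1 + 2 * B + L ≤ S)
    (h₁ : s.toks.card ≤ L) (h₂ : ∀ x ∈ s.toks, code x < W) (h₃ : ∀ d, s.pre d < W)
    (h₄ : ∀ d, s.tot d < W) (h₅ : s.ctr < W) : Fits S W s := by
  constructor
  · simp [words]; omega
  · intro w hw
    simp only [words, List.mem_cons, List.mem_append, List.mem_ofFn, List.mem_map,
      mem_toList] at hw
    rcases hw with rfl | ⟨d, rfl⟩ | ⟨d, rfl⟩ | ⟨x, hx, rfl⟩
    exacts [h₅, h₃ d, h₄ d, h₂ x hx]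

/-- The local states after a sequence of rounds. -/
def run (Rs : List (Round M B)) (X : Fin M → LocalState B) : Fin M → LocalState B :=
  Rs.foldl (fun X R => R.step X) X

/-- A sequence of rounds respects the limits. -/
def Valid (S W : ℕ) : List (Round M B) → (Fin M → LocalState B) → Prop
  | [], X => ∀ i, Fits S W (X i)
  | R :: Rs, X => (∀ i, Fits S W (X i)) ∧ R.Ok S W X ∧ Valid S W Rs (R.step X)

theorem run_take_succ {Rs : List (Round M B)} {X : Fin M → LocalState B} {t : ℕ} {R : Round M B}
    (hR : Rs[t]? = some R) : run (Rs.take (t + 1)) X = R.step (run (Rs.take t) X) := by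
  simp [List.take_add_one, hR, run, List.foldl_append, -List.take_append_getElem]

theorem Valid.fits {S W : ℕ} {Rs : List (Round M B)} {X : Fin M → LocalState B}
    (h : Valid S W Rs X) (t : ℕ) (i : Fin M) : Fits S W (run (Rs.take t) X i) := by
  induction Rs generalizing X t with
  | nil => simpa [run] using h i
  | cons R Rs ih =>
    cases t with
    | zero => simpa [run] using h.1 i
    | succ t => simpa [run] using ih h.2.2 t

theorem Valid.ok {S W : ℕ} {Rs : List (Round M B)} {X : Fin M → LocalState B}
    (h : Valid S W Rs X) {t : ℕ} {R : Round M B} (hR : Rs[t]? = some R) :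
    R.Ok S W (run (Rs.take t) X) := by
  induction Rs generalizing X t with
  | nil => simp at hR
  | cons R' Rs ih =>
    cases t with
    | zero =>
      simp only [List.getElem?_cons_zero, Option.some.injEq] at hR
      subst hR
      simpa [run] using h.2.1
    | succ t => simpa [run] using ih h.2.2 (by simpa using hR)

/-- From local states with the property `P`, the rounds `Rs` respect the limits and lead to local
states with the property `Q`. -/
def Triple (S W : ℕ) (P : (Fin M → LocalState B) → Prop) (Rs : List (Round M B))
    (Q : (Fin M → LocalState B) → Prop) : Prop :=
  ∀ X, P X → Valid S W Rs X ∧ Q (run Rs X)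

section Triple
variable {S W : ℕ} {P Q R : (Fin M → LocalState B) → Prop} {Rs Rs' : List (Round M B)}

theorem Valid.append {X : Fin M → LocalState B} (h : Valid S W Rs X)
    (h' : Valid S W Rs' (run Rs X)) : Valid S W (Rs ++ Rs') X := by
  induction Rs generalizing X with
  | nil => simpa [run] using h'
  | cons R' Rs ih => exact ⟨h.1, h.2.1, ih h.2.2 h'⟩

theorem Triple.append (h : Triple S W P Rs Q) (h' : Triple S W Q Rs' R) :
    Triple S W P (Rs ++ Rs') R := by
  intro X hX
  obtain ⟨h₁, h₂⟩ := h X hX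
  obtain ⟨h₃, h₄⟩ := h' _ h₂
  exact ⟨h₁.append h₃, by simpa [run] using h₄⟩

/-- `I j` is the invariant before pass `j`. The hypothesis `h₀` serves the empty loop, where
validity still demands that the initial states fit. -/
theorem Triple.loop {I : ℕ → (Fin M → LocalState B) → Prop} {body : ℕ → List (Round M B)} (k : ℕ)
    (h₀ : ∀ X, I 0 X → ∀ i, Fits S W (X i))
    (h : ∀ j < k, Triple S W (I j) (body j) (I (j + 1))) :
    Triple S W (I 0) ((List.range k).flatMap body) (I k) := by
  induction k with
  | zero => exact fun X hX => ⟨h₀ X hX, hX⟩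
  | succ k ih =>
    rw [List.range_succ, List.flatMap_append]
    refine (ih fun j hj => h j (by omega)).append ?_
    simpa using h k (by omega)

theorem Triple.single {R' : Round M B} (h₀ : ∀ X, P X → ∀ i, Fits S W (X i))
    (h₁ : ∀ X, P X → R'.Ok S W X) (h₂ : ∀ X, P X → Q (R'.step X))
    (h₃ : ∀ X, Q X → ∀ i, Fits S W (X i)) : Triple S W P [R'] Q :=
  fun X hX => ⟨⟨h₀ X hX, h₁ X hX, h₃ _ (h₂ X hX)⟩, h₂ X hX⟩

end Triple

/-! ### From a sequence of rounds to an `MPCProgram` -/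

/-- The tokens of the edges that a list of words describes; the positions on machine `i` begin
at `i * L`. -/
def load (L : ℕ) (i : Fin M) (x : List ℕ) : LocalState B where
  toks := (range (x.length / 2)).image fun a => (i * L + a, x.getD (2 * a) 0, x.getD (2 * a + 1) 0)
  pre := 0
  tot := 0
  ctr := 0

/-- The list of the second endpoints of the edges in a local state. -/
noncomputable def output (s : LocalState B) : List ℕ := (s.toks.image fun x => x.2.2).toList

/-- The program that performs the rounds `Rs`, after a round that brings the memory into the form of
a local state, and before a round that brings it into the form of a list of nodes. -/
noncomputable abbrev program (S W L : ℕ) (Rs : List (Round M B)) : MPCProgram where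
  machines := M
  memory := S
  wordBound := W
  rounds := Rs.length + 2
  send t i x j := if t = 0 then [] else
    match Rs[t - 1]? with
    | some R => R.send i (ofWords x) j
    | none => []
  receive t i x inbox := if t = 0 then words (load (B := B) L i x) else
    match Rs[t - 1]? with
    | some R => words (R.recv i (ofWords x) inbox)
    | none => output (ofWords (B := B) x)

section program
variable {S W L : ℕ} {Rs : List (Round M B)} {x₀ : Fin M → List ℕ}

theorem state_succ (P : MPCProgram) (x₀ : Fin P.machines → List ℕ) (t : ℕ) :
    P.state x₀ (t + 1) = fun i =>
      P.receive t i (P.state x₀ t i) fun j => P.send t j (P.state x₀ t j) i := rfl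

theorem state_program {t : ℕ} (ht : t ≤ Rs.length) :
    (program S W L Rs).state x₀ (t + 1) =
      fun i : Fin M => words (run (Rs.take t) (fun i => load L i (x₀ i)) i) := by
  induction t with
  | zero => funext i; simp [MPCProgram.state, run]
  | succ t ih =>
    have hR : Rs[t]? = some Rs[t] := List.getElem?_eq_getElem ht
    rw [state_succ, ih (by omega)]
    funext i
    simp only [Nat.add_eq_zero_iff, one_ne_zero, and_false, if_false,
      Nat.add_sub_cancel, hR, ofWords_words]
    rw [run_take_succ hR, Round.step]

theorem final_program :
    (program S W L Rs).final x₀ =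
      fun i : Fin M => output (run Rs (fun i => load L i (x₀ i)) i) := by
  have h : (program S W L Rs).final x₀ =
    (program S W L Rs).state x₀ (Rs.length + 1 + 1) := rfl
  rw [h, state_succ, state_program le_rfl]
  simp

theorem respectsLimits_program (hl : ∀ i, (x₀ i).length ≤ S) (hw : ∀ i, ∀ w ∈ x₀ i, w < W)
    (hv : Valid S W Rs fun i => load L i (x₀ i))
    (hS : ∀ i, (output (run Rs (fun i => load L i (x₀ i)) i)).length ≤ S)
    (hW : ∀ i, ∀ w ∈ output (run Rs (fun i => load L i (x₀ i)) i), w < W) :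
    (program S W L Rs).RespectsLimits x₀ := by
  have hst : ∀ t ≤ Rs.length + 2, ∀ i : Fin M,
      ((program S W L Rs).state x₀ t i).length ≤ S ∧
        ∀ w ∈ (program S W L Rs).state x₀ t i, w < W := by
    intro t ht i
    rcases t with _ | t
    · exact ⟨hl i, hw i⟩
    · rcases Nat.lt_or_ge Rs.length t with h | h
      · obtain rfl : t = Rs.length + 1 := by omega
        have h' : (program S W L Rs).state x₀ (Rs.length + 1 + 1) = _ :=
          final_program (S := S) (W := W) (L := L) (Rs := Rs) (x₀ := x₀)
        rw [h']
        exact ⟨hS i, hW i⟩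
      · rw [state_program h]
        exact hv.fits t i
  -- The two conversion rounds are silent; every other round sends what a round of `Rs` sends from a
  -- reachable state, where `Valid` gives the limits.
  have hm : ∀ t < Rs.length + 2, (∀ i j : Fin M, (program S W L Rs).message x₀ t i j = []) ∨
      ∃ (R : Round M B) (X : Fin M → LocalState B), R.Ok S W X ∧
        ∀ i j : Fin M, (program S W L Rs).message x₀ t i j = R.send i (X i) j := by
    intro t ht
    rcases t with _ | t
    · left; intro i j; simp [MPCProgram.message]
    · rcases Nat.lt_or_ge t Rs.length with h | h
      · right
        have hR : Rs[t]? = some Rs[t] := List.getElem?_eq_getElem h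
        refine ⟨Rs[t], _, hv.ok hR, fun i j => ?_⟩
        rw [MPCProgram.message, state_program h.le]
        simp [hR]
      · left
        intro i j
        have hR : Rs[t]? = none := List.getElem?_eq_none h
        simp [MPCProgram.message, hR]
  constructor
  · exact fun t ht i => (hst t ht i).1
  · intro t ht i
    rcases hm t ht with h | ⟨R, X, h, h'⟩
    · refine (Finset.sum_eq_zero fun j _ => ?_).trans_le (Nat.zero_le _)
      exact congrArg List.length (h i j)
    · exact (Finset.sum_congr rfl fun j _ => congrArg List.length (h' i j)).trans_le (h.sent i)
  · intro t ht i
    rcases hm t ht with h | ⟨R, X, h, h'⟩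
    · refine (Finset.sum_eq_zero fun j _ => ?_).trans_le (Nat.zero_le _)
      exact congrArg List.length (h j i)
    · exact (Finset.sum_congr rfl fun j _ => congrArg List.length (h' j i)).trans_le (h.received i)
  · exact fun t ht i => (hst t ht i).2
  · intro t ht i j w hw
    rcases hm t ht with h | ⟨R, X, h, h'⟩
    · exact absurd ((h i j) ▸ hw) (by simp)
    · exact h.word i j w ((h' i j) ▸ hw)

end program

/-- The local states with given tokens, vectors, and a common counter. -/
def mkState (D : Fin M → Finset (ℕ × ℕ × ℕ)) (pre tot : Fin M → Fin B → ℕ) (p : ℕ) :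
    Fin M → LocalState B := fun i => ⟨D i, pre i, tot i, p⟩

/-- The tokens and the counter respect the limits. -/
structure TokensFit (L W : ℕ) (D : Fin M → Finset (ℕ × ℕ × ℕ)) (p : ℕ) : Prop where
  card_le : ∀ i, (D i).card ≤ L
  code_lt : ∀ i, ∀ x ∈ D i, code x < W
  ctr_lt : p < W

theorem TokensFit.fits {S L W : ℕ} {D : Fin M → Finset (ℕ × ℕ × ℕ)} {p : ℕ}
    (h : TokensFit L W D p) (hS : 1 + 2 * B + L ≤ S) {pre tot : Fin M → Fin B → ℕ}
    (h₁ : ∀ i d, pre i d < W) (h₂ : ∀ i d, tot i d < W) (i : Fin M) :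
    Fits S W (mkState D pre tot p i) :=
  Fits.of_bounds hS (h.card_le i) (h.code_lt i) (h₁ i) (h₂ i) h.ctr_lt

/-! ### Prefix sums -/

/-- Two machines that differ only in the digit `l` of their numbers to base `b`. -/
def Siblings (b l : ℕ) (i j : Fin M) : Prop :=
  (i : ℕ) / b ^ (l + 1) = j / b ^ (l + 1) ∧ (i : ℕ) % b ^ l = j % b ^ l

instance (b l : ℕ) (i j : Fin M) : Decidable (Siblings b l i j) :=
  inferInstanceAs (Decidable (_ ∧ _))

theorem Siblings.symm {b l : ℕ} {i j : Fin M} (h : Siblings b l i j) : Siblings b l j i :=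
  ⟨h.1.symm, h.2.symm⟩

/-- Siblings of `i` agree with it in all digits but one, so that digit identifies them. -/
theorem card_siblings_le {b : ℕ} (hb : 0 < b) (l : ℕ) (i : Fin M) :
    (univ.filter fun j => Siblings b l i j).card ≤ b := by
  refine (card_le_card_of_injOn (t := range b) (fun j : Fin M => (j : ℕ) / b ^ l % b)
    (fun j _ => by simpa using Nat.mod_lt _ hb) ?_).trans_eq
    (card_range b)
  intro j hj k hk h
  simp only [coe_filter, mem_univ, true_and, Set.mem_ofPred_eq, Siblings, pow_succ,
    ← Nat.div_div_eq_div_mul] at hj hk h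
  have h₁ : (j : ℕ) / b ^ l = k / b ^ l := by
    rw [← Nat.div_add_mod ((j : ℕ) / b ^ l) b, ← Nat.div_add_mod ((k : ℕ) / b ^ l) b, h,
      ← hj.1, hk.1]
  have h₂ : (j : ℕ) = k := by
    rw [← Nat.div_add_mod (j : ℕ) (b ^ l), ← Nat.div_add_mod (k : ℕ) (b ^ l), h₁, ← hj.2, hk.2]
  exact Fin.ext h₂

/-- In round `l`, machines that differ only in the digit `l` exchange their sums. -/
def scanRound (b l : ℕ) : Round M B where
  send i s j := if Siblings b l i j then List.ofFn s.tot else []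
  recv i s inbox :=
    { toks := s.toks
      pre := fun d => s.pre d + ∑ j with j < i, (inbox j).getD d 0
      tot := fun d => ∑ j, (inbox j).getD d 0
      ctr := s.ctr }

/-- The sum over the machines whose numbers agree with that of `i` except for the last `l`
digits. -/
def blockSum (b l : ℕ) (x : Fin M → Fin B → ℕ) (i : Fin M) (d : Fin B) : ℕ :=
  ∑ k ∈ univ.filter (fun k : Fin M => (k : ℕ) / b ^ l = i / b ^ l), x k d

/-- The sum over the machines before `i` whose numbers agree with that of `i` except for the
last `l` digits. -/
def blockPre (b l : ℕ) (x : Fin M → Fin B → ℕ) (i : Fin M) (d : Fin B) : ℕ :=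
  ∑ k ∈ univ.filter (fun k : Fin M => (k : ℕ) / b ^ l = i / b ^ l ∧ k < i), x k d

theorem blockSum_le (b l : ℕ) (x : Fin M → Fin B → ℕ) (i : Fin M) (d : Fin B) :
    blockSum b l x i d ≤ ∑ k, x k d :=
  sum_le_sum_of_subset (filter_subset _ _)

theorem blockPre_le (b l : ℕ) (x : Fin M → Fin B → ℕ) (i : Fin M) (d : Fin B) :
    blockPre b l x i d ≤ ∑ k, x k d :=
  sum_le_sum_of_subset (filter_subset _ _)

/-- Combine the upper digits of `k` with the lower `l` digits of `i`. The result is the number of a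
machine because `M` is an exact power of `b`. -/
theorem exists_representative {b h l : ℕ} (hM : M = b ^ h) (hb : 0 < b) (hl : l < h)
    (i k : Fin M) : ∃ j : Fin M, (j : ℕ) / b ^ l = k / b ^ l ∧ (j : ℕ) % b ^ l = i % b ^ l := by
  have hq : 0 < b ^ l := Nat.pow_pos hb
  have hi : (i : ℕ) % b ^ l < b ^ l := Nat.mod_lt _ hq
  refine ⟨⟨(k : ℕ) / b ^ l * b ^ l + i % b ^ l, ?_⟩, ?_, ?_⟩
  · have h₁ : (k : ℕ) / b ^ l < b ^ (h - l) := by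
      rw [Nat.div_lt_iff_lt_mul hq, ← pow_add, Nat.sub_add_cancel hl.le, ← hM]
      exact k.2
    calc (k : ℕ) / b ^ l * b ^ l + i % b ^ l < ((k : ℕ) / b ^ l + 1) * b ^ l := by
          rw [add_mul, one_mul]; omega
      _ ≤ b ^ (h - l) * b ^ l := Nat.mul_le_mul_right _ h₁
      _ = M := by rw [← pow_add, Nat.sub_add_cancel hl.le, ← hM]
  · show ((k : ℕ) / b ^ l * b ^ l + i % b ^ l) / b ^ l = _
    rw [add_comm, Nat.add_mul_div_right _ _ hq, Nat.div_eq_of_lt hi, zero_add]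
  · show ((k : ℕ) / b ^ l * b ^ l + i % b ^ l) % b ^ l = _
    rw [add_comm, Nat.add_mul_mod_self_right, Nat.mod_eq_of_lt hi]

/-- Machines that agree in the lower `l` digits lie in different blocks, so no term is counted
twice. -/
theorem sum_siblings {b h l : ℕ} (hM : M = b ^ h) (hb : 0 < b) (hl : l < h) (y : Fin M → ℕ)
    (i : Fin M) (J : Finset (Fin M)) (hJ : ∀ j ∈ J, (j : ℕ) % b ^ l = i % b ^ l) :
    ∑ j ∈ J, ∑ k ∈ univ.filter (fun k : Fin M => (k : ℕ) / b ^ l = j / b ^ l), y k =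
      ∑ k ∈ univ.filter (fun k : Fin M => ∃ j ∈ J, (k : ℕ) / b ^ l = j / b ^ l), y k := by
  choose r hr₁ hr₂ using exists_representative hM hb hl i
  have key : ∀ j ∈ J, ∀ k : Fin M, r k = j ↔ (k : ℕ) / b ^ l = j / b ^ l := by
    intro j hj k
    constructor
    · rintro rfl
      exact (hr₁ k).symm
    · intro hk
      apply Fin.ext
      rw [← Nat.div_add_mod (r k : ℕ) (b ^ l), ← Nat.div_add_mod (j : ℕ) (b ^ l), hr₁, hr₂, hk,
        hJ j hj]
  rw [← sum_fiberwise_of_maps_to (s := univ.filter _) (t := J) (g := r)]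
  · refine sum_congr rfl fun j hj => sum_congr ?_ fun _ _ => rfl
    ext k
    simp only [mem_filter, mem_univ, true_and]
    constructor
    · exact fun hk => ⟨⟨j, hj, hk⟩, (key j hj k).2 hk⟩
    · exact fun hk => (key j hj k).1 hk.2
  · intro k hk
    obtain ⟨j, hj, hk⟩ := (mem_filter.1 hk).2
    exact ((key j hj k).2 hk) ▸ hj

/-- A block of level `l + 1` is the disjoint union of the level-`l` blocks of the siblings of `i`.
Its machines before `i` are those before `i` in the block of `i`, together with the whole blocks of
the smaller siblings. -/
theorem scanRound_step {b h l : ℕ} (hM : M = b ^ h) (hb : 0 < b) (hl : l < h)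
    (D : Fin M → Finset (ℕ × ℕ × ℕ)) (x : Fin M → Fin B → ℕ) (p : ℕ) :
    (scanRound b l).step (mkState D (blockPre b l x) (blockSum b l x) p) =
      mkState D (blockPre b (l + 1) x) (blockSum b (l + 1) x) p := by
  have hget : ∀ i j : Fin M, ∀ d : Fin B,
      ((if Siblings b l j i then List.ofFn (blockSum b l x j) else []).getD (d : ℕ) 0) =
        if Siblings b l j i then blockSum b l x j d else 0 := by
    intro i j d
    split_ifs <;> simp
  have hdiv : ∀ i j : Fin M, (i : ℕ) / b ^ l = j / b ^ l →
      (i : ℕ) / b ^ (l + 1) = j / b ^ (l + 1) := by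
    intro i j hij
    rw [pow_succ, ← Nat.div_div_eq_div_mul, ← Nat.div_div_eq_div_mul, hij]
  funext i
  simp only [Round.step, scanRound, mkState, hget, LocalState.mk.injEq, true_and, and_true]
  constructor
  · funext d
    rw [← sum_filter, filter_filter]
    unfold blockSum blockPre
    rw [sum_siblings hM hb hl _ i _ (fun j hj => (mem_filter.1 hj).2.2.2), ← sum_union]
    · refine sum_congr ?_ fun _ _ => rfl
      ext k
      simp only [mem_union, mem_filter, mem_univ, true_and]
      constructor
      · rintro (⟨hk, hlt⟩ | ⟨j, ⟨hlt, hs⟩, hk⟩)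
        · exact ⟨hdiv _ _ hk, hlt⟩
        · refine ⟨(hdiv _ _ hk).trans hs.1, ?_⟩
          -- If `k` were not before `i`, then `j < i ≤ k` would put `i` into the block of `j`; a
          -- sibling in the same block is `i` itself.
          by_contra hik
          have h₁ : (i : ℕ) / b ^ l ≤ j / b ^ l := hk ▸ Nat.div_le_div_right (not_lt.1 hik)
          have h₂ : (j : ℕ) / b ^ l ≤ i / b ^ l := Nat.div_le_div_right hlt.le
          have h₃ : (j : ℕ) = i := by
            rw [← Nat.div_add_mod (j : ℕ) (b ^ l), ← Nat.div_add_mod (i : ℕ) (b ^ l),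
              le_antisymm h₂ h₁, hs.2]
          exact hlt.ne (Fin.ext h₃)
      · rintro ⟨hk, hlt⟩
        rcases (Nat.div_le_div_right (c := b ^ l) (show (k : ℕ) ≤ i from hlt.le)).eq_or_lt
          with he | hne
        · exact Or.inl ⟨he, hlt⟩
        · obtain ⟨j, hj₁, hj₂⟩ := exists_representative hM hb hl i k
          refine Or.inr ⟨j, ⟨?_, (hdiv _ _ hj₁).trans hk, hj₂⟩, hj₁.symm⟩
          by_contra hji
          have : (i : ℕ) / b ^ l ≤ j / b ^ l := Nat.div_le_div_right (not_lt.1 hji)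
          omega
    · rw [disjoint_left]
      intro k hk hk'
      simp only [mem_filter, mem_univ, true_and] at hk hk'
      obtain ⟨j, ⟨hlt, hs⟩, hj⟩ := hk'
      have h₃ : (j : ℕ) = i := by
        rw [← Nat.div_add_mod (j : ℕ) (b ^ l), ← Nat.div_add_mod (i : ℕ) (b ^ l), ← hj, hk.1, hs.2]
      exact hlt.ne (Fin.ext h₃)
  · funext d
    rw [← sum_filter]
    unfold blockSum
    rw [sum_siblings hM hb hl _ i _ (fun j hj => (mem_filter.1 hj).2.2)]
    refine sum_congr ?_ fun _ _ => rfl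
    ext k
    simp only [mem_filter, mem_univ, true_and]
    constructor
    · rintro ⟨j, hs, hk⟩
      exact (hdiv _ _ hk).trans hs.1
    · intro hk
      obtain ⟨j, hj₁, hj₂⟩ := exists_representative hM hb hl i k
      exact ⟨j, ⟨(hdiv _ _ hj₁).trans hk, hj₂⟩, hj₁.symm⟩

/-- The rounds that compute the prefix sums over `b ^ h` machines. -/
def scan (b h : ℕ) : List (Round M B) := (List.range h).flatMap fun l => [scanRound b l]

theorem scan_triple {b h S L W : ℕ} (hM : M = b ^ h) (hb : 0 < b) (hS : 1 + 2 * B + L ≤ S)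
    (hbB : b * B ≤ S) {D : Fin M → Finset (ℕ × ℕ × ℕ)} {p : ℕ} (hD : TokensFit L W D p)
    {x : Fin M → Fin B → ℕ} (hx : ∀ d, ∑ k, x k d < W) :
    Triple S W (· = mkState D 0 x p) (scan b h)
      (· = mkState D (fun i d => ∑ k with k < i, x k d) (fun _ d => ∑ k, x k d) p) := by
  have hfit : ∀ l, ∀ X, X = mkState D (blockPre b l x) (blockSum b l x) p →
      ∀ i, Fits S W (X i) := by
    rintro l _ rfl
    exact hD.fits hS (fun i d => (blockPre_le b l x i d).trans_lt (hx d))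
      (fun i d => (blockSum_le b l x i d).trans_lt (hx d))
  -- At level 0 a block is a single machine; at level `h` it is the set of all machines.
  have h0 : mkState D 0 x p = mkState D (blockPre b 0 x) (blockSum b 0 x) p := by
    congr 1
    · funext i d
      symm
      apply sum_eq_zero
      intro k hk
      simp only [pow_zero, Nat.div_one, mem_filter, mem_univ, true_and] at hk
      omega
    · funext i d
      simp only [blockSum, pow_zero, Nat.div_one, Fin.val_inj]
      rw [filter_eq' univ i, if_pos (mem_univ i), sum_singleton]
  have h1 : mkState D (fun i d => ∑ k with k < i, x k d) (fun _ d => ∑ k, x k d) p =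
      mkState D (blockPre b h x) (blockSum b h x) p := by
    have hz : ∀ k : Fin M, (k : ℕ) / b ^ h = 0 := fun k => Nat.div_eq_of_lt (hM ▸ k.2)
    congr 1
    · funext i d
      simp [blockPre, hz]
    · funext i d
      simp [blockSum, hz]
  rw [h0, h1]
  refine Triple.loop (I := fun l X => X = mkState D (blockPre b l x) (blockSum b l x) p) h (hfit 0)
    fun l hl => Triple.single (hfit l) ?_ ?_ (hfit (l + 1))
  · rintro _ rfl
    have hlen : ∀ (i j : Fin M) (t : Fin B → ℕ),
        (if Siblings b l i j then List.ofFn t else []).length =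
          if Siblings b l i j then B else 0 := by
      intro i j t
      split_ifs <;> simp
    constructor
    · intro i
      simp only [scanRound, hlen]
      rw [← sum_filter, sum_const, smul_eq_mul]
      exact (Nat.mul_le_mul_right _ (card_siblings_le hb l i)).trans hbB
    · intro i
      simp only [scanRound, hlen]
      rw [← sum_filter, sum_const, smul_eq_mul]
      refine (Nat.mul_le_mul_right _ ((card_le_card ?_).trans
        (card_siblings_le hb l i))).trans hbB
      intro j hj
      simpa using (mem_filter.1 hj).2.symm
    · intro i j w hw
      simp only [scanRound] at hw
      split_ifs at hw
      · obtain ⟨d, rfl⟩ := List.mem_ofFn.1 hw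
        exact (blockSum_le b l x i d).trans_lt (hx d)
      · simp at hw
  · rintro _ rfl
    exact scanRound_step hM hb hl D x p

/-- A round without communication. -/
def localRound (g : LocalState B → LocalState B) : Round M B where
  send _ _ _ := []
  recv _ s _ := g s

theorem localRound_triple {S W : ℕ} {P Q : (Fin M → LocalState B) → Prop}
    {g : LocalState B → LocalState B} (hP : ∀ X, P X → ∀ i, Fits S W (X i))
    (hQ : ∀ X, Q X → ∀ i, Fits S W (X i)) (h : ∀ X, P X → Q fun i => g (X i)) :
    Triple S W P [localRound g] Q :=
  Triple.single hP (fun X _ => by constructor <;> simp [localRound]) h hQ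

theorem Triple.mono {S W : ℕ} {P P' Q Q' : (Fin M → LocalState B) → Prop}
    {Rs : List (Round M B)} (h : Triple S W P Rs Q) (hP : ∀ X, P' X → P X)
    (hQ : ∀ X, Q X → Q' X) : Triple S W P' Rs Q' :=
  fun X hX => ⟨(h X (hP X hX)).1, hQ _ (h X (hP X hX)).2⟩

/-! ### Placing edges on machines -/

/-- The tokens on machine `i` if the position of every edge `e ∈ X` is `pos e`, and every machine
has `L` positions. -/
def tokensAt (L : ℕ) (X : Finset (ℕ × ℕ)) (pos : ℕ × ℕ → ℕ) (i : ℕ) : Finset (ℕ × ℕ × ℕ) :=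
  (X.filter fun e => pos e / L = i).image fun e => (pos e, e)

/-- The state in which the position of every edge `e ∈ X` is `pos e`. -/
def placed (M B L : ℕ) (X : Finset (ℕ × ℕ)) (pos : ℕ × ℕ → ℕ) (p : ℕ) : Fin M → LocalState B :=
  mkState (fun i => tokensAt L X pos i) 0 0 p

theorem mem_tokensAt {L : ℕ} {X : Finset (ℕ × ℕ)} {pos : ℕ × ℕ → ℕ} {i : ℕ} {x : ℕ × ℕ × ℕ} :
    x ∈ tokensAt L X pos i ↔ x.2 ∈ X ∧ x.1 = pos x.2 ∧ x.1 / L = i := by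
  simp only [tokensAt, mem_image, mem_filter]
  constructor
  · rintro ⟨e, ⟨he, hi⟩, rfl⟩
    exact ⟨he, rfl, hi⟩
  · rintro ⟨h, h', hi⟩
    exact ⟨x.2, ⟨h, h' ▸ hi⟩, by rw [← h']⟩

theorem card_filter_tokensAt {L : ℕ} {X : Finset (ℕ × ℕ)} {pos : ℕ × ℕ → ℕ} {i : ℕ}
    (q : ℕ × ℕ × ℕ → Prop) [DecidablePred q] :
    ((tokensAt L X pos i).filter q).card =
      (X.filter fun e => pos e / L = i ∧ q (pos e, e)).card := by
  rw [tokensAt, filter_image, card_image_of_injective _ fun e e' h => (Prod.mk.inj h).2,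
    filter_filter]

theorem sum_card_filter {ι κ : Type*} [DecidableEq κ] (X : Finset ι) (f : ι → κ)
    (q : ι → Prop) [DecidablePred q] (J : Finset κ) :
    ∑ k ∈ J, (X.filter fun e => f e = k ∧ q e).card = (X.filter fun e => f e ∈ J ∧ q e).card := by
  rw [card_eq_sum_card_fiberwise (f := f) (t := J) fun e he => (mem_filter.1 he).2.1]
  refine sum_congr rfl fun k hk => congrArg card ?_
  ext e
  simp only [mem_filter]
  constructor
  · rintro ⟨h₁, rfl, h₂⟩
    exact ⟨⟨h₁, hk, h₂⟩, rfl⟩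
  · rintro ⟨⟨h₁, _, h₂⟩, rfl⟩
    exact ⟨h₁, rfl, h₂⟩

theorem sum_card_filter_fin {ι : Type*} (X : Finset ι) (f : ι → ℕ)
    (q : ι → Prop) [DecidablePred q] (J : Finset (Fin M)) :
    ∑ k ∈ J, (X.filter fun e => f e = (k : ℕ) ∧ q e).card =
      (X.filter fun e => (∃ k ∈ J, (k : ℕ) = f e) ∧ q e).card := by
  have h := sum_card_filter X f q (J.map Fin.valEmbedding)
  rw [sum_map] at h
  simpa using h

/-- The positions are pairwise distinct positions of `M` machines with `L` positions each. -/
structure IsPlacement (M L : ℕ) (X : Finset (ℕ × ℕ)) (pos : ℕ × ℕ → ℕ) : Prop where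
  inj : ∀ e ∈ X, ∀ e' ∈ X, pos e = pos e' → e = e'
  lt : ∀ e ∈ X, pos e < M * L

theorem IsPlacement.mono {L : ℕ} {X Y : Finset (ℕ × ℕ)} {pos : ℕ × ℕ → ℕ}
    (h : IsPlacement M L X pos) (hY : Y ⊆ X) : IsPlacement M L Y pos :=
  ⟨fun e he e' he' => h.inj e (hY he) e' (hY he'), fun e he => h.lt e (hY he)⟩

theorem IsPlacement.card_le {L : ℕ} {X : Finset (ℕ × ℕ)} {pos : ℕ × ℕ → ℕ}
    (h : IsPlacement M L X pos) : X.card ≤ M * L := by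
  rw [← card_range (M * L)]
  exact card_le_card_of_injOn pos (fun e he => by simpa using h.lt e he)
    fun e he e' he' => h.inj e he e' he'

theorem card_filter_div_le {L : ℕ} (hL : 0 < L) {X : Finset (ℕ × ℕ)} {pos : ℕ × ℕ → ℕ}
    (h : ∀ e ∈ X, ∀ e' ∈ X, pos e = pos e' → e = e') (i : ℕ) :
    (X.filter fun e => pos e / L = i).card ≤ L := by
  have h₁ : (Ico (i * L) (i * L + L)).card = L := by simp
  refine (card_le_card_of_injOn pos ?_ ?_).trans_eq h₁
  · intro e he
    have := (mem_filter.1 he).2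
    rw [Nat.div_eq_iff hL] at this
    simp only [coe_Ico, Set.mem_Ico]
    omega
  · exact fun e he e' he' => h e (mem_filter.1 he).1 e' (mem_filter.1 he').1

theorem IsPlacement.tokensFit {L W p : ℕ} (hL : 0 < L) {X : Finset (ℕ × ℕ)} {pos : ℕ × ℕ → ℕ}
    (h : IsPlacement M L X pos) (hW : ∀ a < M * L, ∀ e ∈ X, code (a, e) < W) (hp : p < W) :
    TokensFit L W (fun i : Fin M => tokensAt L X pos i) p := by
  refine ⟨fun i => card_image_le.trans (card_filter_div_le hL h.inj i), fun i x hx => ?_, hp⟩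
  obtain ⟨h₁, h₂, -⟩ := mem_tokensAt.1 hx
  have := hW x.1 (h₂ ▸ h.lt _ h₁) x.2 h₁
  simpa using this

theorem IsPlacement.fits {S L W p : ℕ} (hL : 0 < L) {X : Finset (ℕ × ℕ)} {pos : ℕ × ℕ → ℕ}
    (h : IsPlacement M L X pos) (hW : ∀ a < M * L, ∀ e ∈ X, code (a, e) < W) (hp : p < W)
    (hS : 1 + 2 * B + L ≤ S) (i : Fin M) : Fits S W (placed M B L X pos p i) :=
  (h.tokensFit hL hW hp).fits hS (fun _ _ => Nat.zero_lt_of_lt hp)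
    (fun _ _ => Nat.zero_lt_of_lt hp) i

/-! ### Radix sort -/

section sort
variable [NeZero B]

/-- The digit `j` of a number to base `B`. -/
def digit (B : ℕ) [NeZero B] (j u : ℕ) : Fin B := Fin.ofNat B (u / B ^ j)

/-- Every machine counts its edges `(u, v)` by the digit `j` of `u`. -/
def countRound (j : ℕ) : Round M B := localRound fun s =>
  { toks := s.toks
    pre := 0
    tot := fun d => (s.toks.filter fun x => digit B j x.2.1 = d).card
    ctr := s.ctr }

/-- The position of a token in the order by the digit `j`, computed from prefix sums. -/
def newPos (j : ℕ) (s : LocalState B) (x : ℕ × ℕ × ℕ) : ℕ :=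
  ∑ d ∈ univ.filter (· < digit B j x.2.1), s.tot d + s.pre (digit B j x.2.1) +
    (s.toks.filter fun y => digit B j y.2.1 = digit B j x.2.1 ∧ y.1 < x.1).card

/-- Every edge is sent to its new position. -/
noncomputable def permuteRound (L j : ℕ) : Round M B where
  send _ s k := (s.toks.filter fun x => newPos j s x / L = k).toList.map fun x =>
    code (newPos j s x, x.2)
  recv _ s inbox :=
    { toks := univ.biUnion fun k => ((inbox k).map decode).toFinset
      pre := 0
      tot := 0
      ctr := s.ctr }

/-- The order of edges by the digit `j` of the first endpoint, and then by position. -/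
def Before (B : ℕ) [NeZero B] (j : ℕ) (pos : ℕ × ℕ → ℕ) (e e' : ℕ × ℕ) : Prop :=
  digit B j e.1 < digit B j e'.1 ∨ digit B j e.1 = digit B j e'.1 ∧ pos e < pos e'

instance (j : ℕ) (pos : ℕ × ℕ → ℕ) (e e' : ℕ × ℕ) : Decidable (Before B j pos e e') :=
  inferInstanceAs (Decidable (_ ∨ _))

/-- The number of edges before a given one. -/
def rank (B : ℕ) [NeZero B] (j : ℕ) (X : Finset (ℕ × ℕ)) (pos : ℕ × ℕ → ℕ) (e : ℕ × ℕ) : ℕ :=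
  (X.filter fun e' => Before B j pos e' e).card

theorem Before.irrefl {j : ℕ} {pos : ℕ × ℕ → ℕ} (e : ℕ × ℕ) : ¬ Before B j pos e e := by
  simp [Before]

theorem Before.trans {j : ℕ} {pos : ℕ × ℕ → ℕ} {e e' e'' : ℕ × ℕ} (h : Before B j pos e e')
    (h' : Before B j pos e' e'') : Before B j pos e e'' := by
  unfold Before at *
  rcases h with h | ⟨h₁, h₂⟩ <;> rcases h' with h' | ⟨h₁', h₂'⟩
  · exact Or.inl (h.trans h')
  · exact Or.inl (h₁' ▸ h)
  · exact Or.inl (h₁ ▸ h')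
  · exact Or.inr ⟨h₁.trans h₁', h₂.trans h₂'⟩

theorem rank_lt_rank {j : ℕ} {X : Finset (ℕ × ℕ)} {pos : ℕ × ℕ → ℕ} {e e' : ℕ × ℕ} (he : e ∈ X)
    (h : Before B j pos e e') : rank B j X pos e < rank B j X pos e' := by
  apply card_lt_card
  rw [ssubset_iff_of_subset]
  · exact ⟨e, mem_filter.2 ⟨he, h⟩, fun h' => Before.irrefl e (mem_filter.1 h').2⟩
  · exact fun a ha => mem_filter.2 ⟨(mem_filter.1 ha).1, (mem_filter.1 ha).2.trans h⟩

theorem rank_lt_card {j : ℕ} {X : Finset (ℕ × ℕ)} {pos : ℕ × ℕ → ℕ} {e : ℕ × ℕ} (he : e ∈ X) :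
    rank B j X pos e < X.card := by
  apply card_lt_card
  rw [ssubset_iff_of_subset (filter_subset _ _)]
  exact ⟨e, he, fun h' => Before.irrefl e (mem_filter.1 h').2⟩

/-- Distinct positions break all ties, so `Before` is a strict total order on `X` and ranks are
distinct. -/
theorem rank_isPlacement {L j : ℕ} {X : Finset (ℕ × ℕ)} {pos : ℕ × ℕ → ℕ}
    (h : IsPlacement M L X pos) : IsPlacement M L X (rank B j X pos) := by
  refine ⟨fun e he e' he' hr => ?_, fun e he => (rank_lt_card he).trans_le h.card_le⟩
  by_contra hne
  have hpos : pos e ≠ pos e' := fun h' => hne (h.inj e he e' he' h')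
  have : Before B j pos e e' ∨ Before B j pos e' e := by
    unfold Before
    rcases lt_trichotomy (digit B j e.1) (digit B j e'.1) with h₁ | h₁ | h₁
    · exact Or.inl (Or.inl h₁)
    · rcases hpos.lt_or_gt with h₂ | h₂
      · exact Or.inl (Or.inr ⟨h₁, h₂⟩)
      · exact Or.inr (Or.inr ⟨h₁.symm, h₂⟩)
    · exact Or.inr (Or.inl h₁)
  rcases this with h' | h'
  · exact (rank_lt_rank he h').ne hr
  · exact (rank_lt_rank he' h').ne hr.symm

theorem div_lt_of_placement {L : ℕ} {X : Finset (ℕ × ℕ)} {pos : ℕ × ℕ → ℕ}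
    (h : IsPlacement M L X pos) {e : ℕ × ℕ} (he : e ∈ X) : pos e / L < M :=
  Nat.div_lt_of_lt_mul (by rw [mul_comm]; exact h.lt e he)

/-- The counts of the tokens by digits. -/
def counts (B L j : ℕ) [NeZero B] (X : Finset (ℕ × ℕ)) (pos : ℕ × ℕ → ℕ) (k : Fin M)
    (d : Fin B) : ℕ :=
  ((tokensAt L X pos k).filter fun x => digit B j x.2.1 = d).card

theorem sum_counts {L j : ℕ} {X : Finset (ℕ × ℕ)} {pos : ℕ × ℕ → ℕ} (J : Finset (Fin M))
    (d : Fin B) :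
    ∑ k ∈ J, counts B L j X pos k d =
      (X.filter fun e => (∃ k ∈ J, (k : ℕ) = pos e / L) ∧ digit B j e.1 = d).card := by
  simp only [counts, card_filter_tokensAt]
  rw [← sum_card_filter_fin]

theorem sum_counts_univ {L j : ℕ} {X : Finset (ℕ × ℕ)} {pos : ℕ × ℕ → ℕ}
    (h : IsPlacement M L X pos) (d : Fin B) :
    ∑ k : Fin M, counts B L j X pos k d = (X.filter fun e => digit B j e.1 = d).card := by
  rw [sum_counts]
  congr 1
  refine filter_congr fun e he => and_iff_right ⟨⟨pos e / L, div_lt_of_placement h he⟩, ?_⟩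
  simp

/-- The state after the counts have been summed. -/
def summed (M B L j : ℕ) [NeZero B] (X : Finset (ℕ × ℕ)) (pos : ℕ × ℕ → ℕ) (p : ℕ) :
    Fin M → LocalState B :=
  mkState (fun i => tokensAt L X pos i)
    (fun i d => ∑ k with k < i, counts B L j X pos k d)
    (fun _ d => ∑ k : Fin M, counts B L j X pos k d) p

/-- The edges before a given one fall into three disjoint classes: a smaller digit; the same digit
on an earlier machine; the same digit on the same machine at a smaller position. The totals, the
prefix sums and the local tokens count one class each. -/
theorem newPos_eq_rank {L j p : ℕ} {X : Finset (ℕ × ℕ)} {pos : ℕ × ℕ → ℕ}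
    (h : IsPlacement M L X pos) {i : Fin M} {x : ℕ × ℕ × ℕ}
    (hx : x ∈ tokensAt L X pos i) :
    newPos j (summed M B L j X pos p i) x = rank B j X pos x.2 := by
  obtain ⟨hX, hpos, hi⟩ := mem_tokensAt.1 hx
  have h₁ : ∑ d ∈ univ.filter (· < digit B j x.2.1), ∑ k : Fin M, counts B L j X pos k d =
      (X.filter fun e => digit B j e.1 < digit B j x.2.1).card := by
    simp only [sum_counts_univ h]
    have := sum_card_filter X (fun e => digit B j e.1) (fun _ => True)
      (univ.filter (· < digit B j x.2.1))
    simpa using this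
  have h₂ : ∑ k with k < i, counts B L j X pos k (digit B j x.2.1) =
      (X.filter fun e => pos e / L < i ∧ digit B j e.1 = digit B j x.2.1).card := by
    rw [sum_counts]
    congr 1
    refine filter_congr fun e he => and_congr_left' ?_
    constructor
    · rintro ⟨k, hk, hk'⟩
      rw [← hk']
      exact (mem_filter.1 hk).2
    · intro hlt
      exact ⟨⟨pos e / L, div_lt_of_placement h he⟩, mem_filter.2 ⟨mem_univ _, hlt⟩, rfl⟩
  have h₃ : ((tokensAt L X pos i).filter fun y =>
      digit B j y.2.1 = digit B j x.2.1 ∧ y.1 < x.1).card =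
      (X.filter fun e =>
        pos e / L = i ∧ digit B j e.1 = digit B j x.2.1 ∧ pos e < pos x.2).card := by
    rw [card_filter_tokensAt, hpos]
  simp only [newPos, summed, mkState]
  rw [h₁, h₂, h₃, ← card_union_of_disjoint, ← card_union_of_disjoint, rank]
  · congr 1
    ext e
    have hdiv : pos e < pos x.2 → pos e / L ≤ i := fun hlt => by
      rw [← hi, hpos]
      exact Nat.div_le_div_right hlt.le
    have hdiv' : pos e / L < i → pos e < pos x.2 := fun hlt => by
      by_contra hc
      have := Nat.div_le_div_right (c := L) (not_lt.1 hc)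
      rw [← hpos, hi] at this
      omega
    simp only [mem_union, mem_filter]
    constructor
    · rintro ((⟨h₁, h₂⟩ | ⟨h₁, h₂, h₃⟩) | ⟨h₁, h₂, h₃, h₄⟩)
      · exact ⟨h₁, Or.inl h₂⟩
      · exact ⟨h₁, Or.inr ⟨h₃, hdiv' h₂⟩⟩
      · exact ⟨h₁, Or.inr ⟨h₃, h₄⟩⟩
    · rintro ⟨h₁, h₂ | ⟨h₂, h₃⟩⟩
      · exact Or.inl (Or.inl ⟨h₁, h₂⟩)
      · rcases (hdiv h₃).lt_or_eq with h₄ | h₄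
        · exact Or.inl (Or.inr ⟨h₁, h₄, h₂⟩)
        · exact Or.inr ⟨h₁, h₄, h₂, h₃⟩
  · rw [disjoint_left]
    intro e he he'
    simp only [mem_union, mem_filter] at he he'
    rcases he with he | he
    · exact he.2.ne he'.2.2.1
    · exact he.2.1.ne he'.2.1
  · rw [disjoint_left]
    intro e he he'
    simp only [mem_filter] at he he'
    exact he.2.ne he'.2.2

theorem permuteRound_step {L j p : ℕ} {X : Finset (ℕ × ℕ)} {pos : ℕ × ℕ → ℕ}
    (h : IsPlacement M L X pos) :
    (permuteRound L j).step (summed M B L j X pos p) = placed M B L X (rank B j X pos) p := by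
  funext i
  simp only [Round.step, permuteRound, placed, mkState, LocalState.mk.injEq]
  refine ⟨?_, rfl, rfl, rfl⟩
  ext x
  simp only [mem_biUnion, mem_univ, true_and, List.mem_toFinset, List.mem_map, mem_toList,
    mem_filter, mem_tokensAt]
  constructor
  · rintro ⟨k, w, ⟨y, ⟨hy, hi⟩, rfl⟩, rfl⟩
    have hy' : y ∈ tokensAt L X pos k := hy
    rw [newPos_eq_rank h hy'] at hi ⊢
    rw [decode_code]
    exact ⟨(mem_tokensAt.1 hy').1, rfl, hi⟩
  · rintro ⟨h₁, h₂, h₃⟩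
    have hy : (pos x.2, x.2) ∈ tokensAt L X pos (⟨pos x.2 / L, div_lt_of_placement h h₁⟩ : Fin M) :=
      mem_tokensAt.2 ⟨h₁, rfl, rfl⟩
    refine ⟨⟨pos x.2 / L, div_lt_of_placement h h₁⟩, _, ⟨(pos x.2, x.2), ⟨hy, ?_⟩, rfl⟩, ?_⟩
    · rw [newPos_eq_rank h hy, ← h₃, h₂]
    · rw [decode_code, newPos_eq_rank h hy, ← h₂]

/-- A machine sends at most the `L` tokens that it holds, and receives at most `L` because the ranks
are distinct and only `L` of them belong to it. -/
theorem permuteRound_ok {S W L j p : ℕ} (hL : 0 < L) (hLS : L ≤ S) {X : Finset (ℕ × ℕ)}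
    {pos : ℕ × ℕ → ℕ} (h : IsPlacement M L X pos)
    (hW : ∀ a < M * L, ∀ e ∈ X, code (a, e) < W) :
    (permuteRound L j).Ok S W (summed M B L j X pos p) := by
  have hr := rank_isPlacement (B := B) (j := j) h
  have hf : ∀ i k : Fin M, ((tokensAt L X pos i).filter fun x =>
      newPos j (summed M B L j X pos p i) x / L = k).card =
      (X.filter fun e => pos e / L = i ∧ rank B j X pos e / L = k).card := by
    intro i k
    rw [← card_filter_tokensAt (q := fun x => rank B j X pos x.2 / L = (k : ℕ))]
    congr 1
    exact filter_congr fun x hx => by rw [newPos_eq_rank h hx]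
  constructor
  · intro i
    simp only [permuteRound, List.length_map, length_toList]
    refine le_trans (le_of_eq_of_le (sum_congr rfl fun k _ => hf i k) ?_) hLS
    simp only [and_comm (a := pos _ / L = (i : ℕ))]
    rw [sum_card_filter_fin]
    exact (card_le_card fun e he => mem_filter.2 ⟨(mem_filter.1 he).1, (mem_filter.1 he).2.2⟩).trans
      (card_filter_div_le hL h.inj i)
  · intro i
    simp only [permuteRound, List.length_map, length_toList]
    refine le_trans (le_of_eq_of_le (sum_congr rfl fun k _ => hf k i) ?_) hLS
    rw [sum_card_filter_fin]
    exact (card_le_card fun e he => mem_filter.2 ⟨(mem_filter.1 he).1, (mem_filter.1 he).2.2⟩).trans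
      (card_filter_div_le hL hr.inj i)
  · intro i k w hw
    simp only [permuteRound, List.mem_map, mem_toList, mem_filter] at hw
    obtain ⟨x, ⟨hx, -⟩, rfl⟩ := hw
    have hx' : x ∈ tokensAt L X pos i := hx
    rw [newPos_eq_rank h hx']
    exact hW _ (hr.lt _ (mem_tokensAt.1 hx').1) _ (mem_tokensAt.1 hx').1

/-- The rounds that sort the edges by the first endpoint. -/
noncomputable def sort (b h k L : ℕ) : List (Round M B) :=
  (List.range k).flatMap fun j => [countRound j] ++ (scan b h ++ [permuteRound L j])

theorem sort_step_triple {b h S L W j p : ℕ} (hM : M = b ^ h) (hb : 0 < b) (hL : 0 < L)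
    (hS : 1 + 2 * B + L ≤ S) (hbB : b * B ≤ S) {X : Finset (ℕ × ℕ)} {pos : ℕ × ℕ → ℕ}
    (hpos : IsPlacement M L X pos) (hW : ∀ a < M * L, ∀ e ∈ X, code (a, e) < W) (hp : p < W)
    (hXW : X.card < W) :
    Triple S W (· = placed M B L X pos p) ([countRound j] ++ (scan b h ++ [permuteRound L j]))
      (· = placed M B L X (rank B j X pos) p) := by
  have htf := hpos.tokensFit hL hW hp
  have hsum : ∀ d, ∑ k : Fin M, counts B L j X pos k d < W := fun d => by
    rw [sum_counts_univ hpos]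
    exact (card_filter_le _ _).trans_lt hXW
  have hle : ∀ i d, counts B L j X pos (i : Fin M) d ≤ ∑ k : Fin M, counts B L j X pos k d :=
    fun i d => single_le_sum (f := fun k : Fin M => counts B L j X pos k d)
      (fun _ _ => Nat.zero_le _) (mem_univ i)
  have h₁ : Triple S W (· = placed M B L X pos p) [countRound j]
      (· = mkState (fun i => tokensAt L X pos i) 0 (counts B L j X pos) p) := by
    refine localRound_triple ?_ ?_ ?_
    · rintro _ rfl
      exact hpos.fits hL hW hp hS
    · rintro _ rfl
      exact htf.fits hS (fun _ _ => Nat.zero_lt_of_lt hp) fun i d => (hle i d).trans_lt (hsum d)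
    · rintro _ rfl
      rfl
  refine h₁.append ((scan_triple hM hb hS hbB htf hsum).append (Triple.single ?_ ?_ ?_ ?_))
  · rintro _ rfl
    exact htf.fits hS (fun i d => (sum_le_sum_of_subset (filter_subset _ _)).trans_lt (hsum d))
      fun _ d => hsum d
  · rintro _ rfl
    exact permuteRound_ok hL (by omega) hpos hW
  · rintro _ rfl
    exact permuteRound_step hpos
  · rintro _ rfl
    exact (rank_isPlacement hpos).fits hL hW hp hS

/-- The edges occupy an initial interval of the positions, ordered by the first endpoint. -/
structure IsSorted (M L : ℕ) (X : Finset (ℕ × ℕ)) (pos : ℕ × ℕ → ℕ) : Prop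
    extends IsPlacement M L X pos where
  lt_card : ∀ e ∈ X, pos e < X.card
  mono : ∀ e ∈ X, ∀ e' ∈ X, e.1 < e'.1 → pos e < pos e'

theorem sort_triple {b h k S L W p : ℕ} (hM : M = b ^ h) (hb : 0 < b) (hL : 0 < L)
    (hS : 1 + 2 * B + L ≤ S) (hbB : b * B ≤ S) {X : Finset (ℕ × ℕ)} (hk : 0 < k)
    (hX : ∀ e ∈ X, e.1 < B ^ k) (hW : ∀ a < M * L, ∀ e ∈ X, code (a, e) < W) (hp : p < W)
    (hXW : X.card < W) :
    Triple S W (fun Y => ∃ pos, IsPlacement M L X pos ∧ Y = placed M B L X pos p) (sort b h k L)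
      (fun Y => ∃ pos, IsSorted M L X pos ∧ Y = placed M B L X pos p) := by
  -- Radix sort from the least significant digit: after `j` passes the edges are ordered by the last
  -- `j` digits. Positions may have gaps until the first pass, hence the guard `0 < j` and the need
  -- for `0 < k`.
  have key := Triple.loop (S := S) (W := W)
    (I := fun j (Y : Fin M → LocalState B) => ∃ pos, IsPlacement M L X pos ∧
      (∀ e ∈ X, ∀ e' ∈ X, e.1 % B ^ j < e'.1 % B ^ j → pos e < pos e') ∧
      (0 < j → ∀ e ∈ X, pos e < X.card) ∧ Y = placed M B L X pos p)
    (body := fun j => [countRound j] ++ (scan b h ++ [permuteRound L j])) k ?_ ?_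
  · refine key.mono ?_ ?_
    · rintro Y ⟨pos, h₁, h₂⟩
      exact ⟨pos, h₁, by simp [Nat.mod_one], by simp, h₂⟩
    · rintro Y ⟨pos, h₁, h₂, h₃, h₄⟩
      refine ⟨pos, ⟨h₁, h₃ hk, fun e he e' he' hlt => h₂ e he e' he' ?_⟩, h₄⟩
      rwa [Nat.mod_eq_of_lt (hX e he), Nat.mod_eq_of_lt (hX e' he')]
  · rintro Y ⟨pos, h₁, -, -, rfl⟩
    exact h₁.fits hL hW hp hS
  · rintro j - Y ⟨pos, h₁, h₂, -, h₄⟩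
    obtain ⟨hv, hr⟩ := sort_step_triple (j := j) hM hb hL hS hbB h₁ hW hp hXW Y h₄
    refine ⟨hv, _, rank_isPlacement h₁, fun e he e' he' hlt => rank_lt_rank he ?_,
      fun _ e he => rank_lt_card he, hr⟩
    rw [Nat.mod_pow_succ, Nat.mod_pow_succ] at hlt
    have hB : 0 < B ^ j := Nat.pow_pos (NeZero.pos B)
    have hm : e.1 % B ^ j < B ^ j := Nat.mod_lt _ hB
    have hm' : e'.1 % B ^ j < B ^ j := Nat.mod_lt _ hB
    -- The new digit decides; if it is equal, stability keeps the order of the lower digits.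
    rcases lt_trichotomy (e.1 / B ^ j % B) (e'.1 / B ^ j % B) with h | h | h
    · left
      rw [Fin.lt_def]
      simpa [digit] using h
    · right
      refine ⟨Fin.ext (by simpa [digit] using h), h₂ e he e' he' ?_⟩
      rw [h] at hlt
      omega
    · exfalso
      have := Nat.mul_le_mul_left (B ^ j) (show e'.1 / B ^ j % B + 1 ≤ e.1 / B ^ j % B from h)
      rw [mul_add, mul_one] at this
      linarith [Nat.zero_le (e.1 % B ^ j)]

/-! ### The method of conditional expectations -/

/-- The index of a smallest entry of a vector. -/
noncomputable def argMin (f : Fin B → ℕ) : Fin B := (Finite.exists_min f).choose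

theorem argMin_le (f : Fin B → ℕ) (d : Fin B) : f (argMin f) ≤ f d :=
  (Finite.exists_min f).choose_spec d

/-- For every value of the digit `j`, every machine adds up the costs of the candidates whose
first digits are those of the counter and this value. -/
def voteRound (k : ℕ) (g : Finset (ℕ × ℕ × ℕ) → ℕ → ℕ) (j : ℕ) : Round M B := localRound fun s =>
  { toks := s.toks
    pre := 0
    tot := fun d => ∑ t ∈ (range (B ^ k)).filter (fun t => t % B ^ (j + 1) = s.ctr + d * B ^ j),
      g s.toks t
    ctr := s.ctr }

/-- The digit `j` of the counter becomes the one with the smallest cost. -/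
noncomputable def pickRound (j : ℕ) : Round M B := localRound fun s : LocalState B =>
  { toks := s.toks
    pre := 0
    tot := 0
    ctr := s.ctr + argMin s.tot * B ^ j }

/-- The rounds that find a candidate below `B ^ k` of total cost zero. -/
noncomputable def select (b h k : ℕ) (g : Finset (ℕ × ℕ × ℕ) → ℕ → ℕ) : List (Round M B) :=
  (List.range k).flatMap fun j => [voteRound k g j] ++ (scan b h ++ [pickRound j])

/-- Among the `B` values of the next digit, the cheapest has at most a fraction `1 / B` of the
current cost. Hence cost times `B ^ j` stays below `B ^ k`; after `k` digits one candidate is left,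
of integral cost below 1. -/
theorem select_triple {b h k S L W : ℕ} (hM : M = b ^ h) (hb : 0 < b)
    (hS : 1 + 2 * B + L ≤ S) (hbB : b * B ≤ S) {D : Fin M → Finset (ℕ × ℕ × ℕ)}
    (hD : TokensFit L W D 0) (g : Finset (ℕ × ℕ × ℕ) → ℕ → ℕ) (hW : B ^ k ≤ W)
    (hg : ∑ t ∈ range (B ^ k), ∑ i, g (D i) t < B ^ k) :
    Triple (B := B) S W (· = mkState D 0 0 0) (select b h k g)
      (fun Y => ∃ p < B ^ k, Y = mkState D 0 0 p ∧ ∀ i, g (D i) p = 0) := by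
  have hW0 : 0 < W := hD.ctr_lt
  have hB : 0 < B := NeZero.pos B
  have hD' : ∀ p < B ^ k, TokensFit L W D p := fun p hp =>
    ⟨hD.card_le, hD.code_lt, hp.trans_le hW⟩
  have hfit : ∀ p < B ^ k, ∀ i, Fits S W (mkState D (0 : Fin M → Fin B → ℕ) 0 p i) :=
    fun p hp => (hD' p hp).fits hS (fun _ _ => hW0) fun _ _ => hW0
  have key := Triple.loop (S := S) (W := W)
    (I := fun j (Y : Fin M → LocalState B) => j ≤ k → ∃ p < B ^ j, Y = mkState D 0 0 p ∧
      (∑ t ∈ (range (B ^ k)).filter (fun t => t % B ^ j = p), ∑ i, g (D i) t) * B ^ j < B ^ k)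
    (body := fun j => [voteRound k g j] ++ (scan b h ++ [pickRound j])) k ?_ ?_
  · refine key.mono ?_ ?_
    · rintro _ rfl -
      exact ⟨0, by simp, rfl, by simpa [Nat.mod_one] using hg⟩
    · rintro Y hY
      obtain ⟨p, hp, rfl, h⟩ := hY le_rfl
      refine ⟨p, hp, rfl, ?_⟩
      have hf : (range (B ^ k)).filter (fun t => t % B ^ k = p) = {p} := by
        ext t
        simp only [mem_filter, mem_range, mem_singleton]
        constructor
        · rintro ⟨h₁, h₂⟩
          rwa [Nat.mod_eq_of_lt h₁] at h₂
        · rintro rfl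
          exact ⟨hp, Nat.mod_eq_of_lt hp⟩
      rw [hf, sum_singleton] at h
      have h0 : ∑ i, g (D i) p = 0 := by
        by_contra hne
        have := Nat.le_mul_of_pos_left (B ^ k) (Nat.pos_of_ne_zero hne)
        omega
      intro i
      exact (sum_eq_zero_iff.1 h0) i (mem_univ i)
  · rintro X hX
    obtain ⟨p, hp, rfl, -⟩ := hX (Nat.zero_le _)
    exact hfit p (hp.trans_le (Nat.pow_le_pow_right hB (Nat.zero_le _)))
  · intro j hj X hX
    obtain ⟨p, hp, rfl, h⟩ := hX hj.le
    have hpk : p < B ^ k := hp.trans_le (Nat.pow_le_pow_right hB hj.le)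
    set x : Fin M → Fin B → ℕ := fun i d =>
      ∑ t ∈ (range (B ^ k)).filter (fun t => t % B ^ (j + 1) = p + d * B ^ j), g (D i) t with hx
    set H : Fin B → ℕ := fun d => ∑ i, x i d with hH
    have hH' : ∀ d, H d = ∑ t ∈ (range (B ^ k)).filter (fun t => t % B ^ (j + 1) = p + d * B ^ j),
        ∑ i, g (D i) t := fun d => sum_comm
    have hHW : ∀ d, H d < W := fun d => by
      rw [hH']
      exact ((sum_le_sum_of_subset (filter_subset _ _)).trans_lt hg).trans_le hW
    have hlt : p + argMin H * B ^ j < B ^ (j + 1) := by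
      have h₁ := (argMin H).2
      calc p + argMin H * B ^ j < B ^ j + argMin H * B ^ j := by omega
        _ = (argMin H + 1) * B ^ j := by ring
        _ ≤ B * B ^ j := Nat.mul_le_mul_right _ h₁
        _ = B ^ (j + 1) := by ring
    have hltk : p + argMin H * B ^ j < B ^ k := hlt.trans_le (Nat.pow_le_pow_right hB hj)
    have h₁ : Triple S W (· = mkState D 0 0 p) [voteRound k g j] (· = mkState D 0 x p) := by
      refine localRound_triple ?_ ?_ ?_
      · rintro _ rfl
        exact hfit p hpk
      · rintro _ rfl
        refine (hD' p hpk).fits hS (fun _ _ => hW0) fun i d => lt_of_le_of_lt ?_ (hHW d)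
        exact single_le_sum (f := fun i => x i d) (fun _ _ => Nat.zero_le _) (mem_univ i)
      · rintro _ rfl
        rfl
    have h₂ := h₁.append ((scan_triple hM hb hS hbB (hD' p hpk) hHW).append
      (Triple.single (R' := pickRound j)
        (Q := (· = mkState D 0 0 (p + argMin H * B ^ j))) ?_ ?_ ?_ ?_))
    · obtain ⟨h₃, h₄⟩ := h₂ _ rfl
      refine ⟨h₃, fun _ => ⟨_, hlt, h₄, lt_of_le_of_lt ?_ h⟩⟩
      rw [← hH', pow_succ', ← mul_assoc]
      refine Nat.mul_le_mul_right _ ?_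
      calc H (argMin H) * B = ∑ _d : Fin B, H (argMin H) := by simp [mul_comm]
        _ ≤ ∑ d, H d := sum_le_sum fun d _ => argMin_le H d
        _ = _ := ?_
      simp only [hH']
      -- The candidates compatible with the counter are split by their digit `j`; these classes are
      -- the ones whose costs were added up for each `d`.
      rw [← sum_fiberwise_of_maps_to (s := (range (B ^ k)).filter (fun t => t % B ^ j = p))
        (t := univ) (g := fun t => digit B j t) fun _ _ => mem_univ _]
      refine sum_congr rfl fun d _ => sum_congr ?_ fun _ _ => rfl
      ext t
      have hd : digit B j t = d ↔ t / B ^ j % B = d := by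
        rw [Fin.ext_iff]
        simp [digit]
      simp only [mem_filter, hd, and_assoc]
      refine and_congr_right fun _ => ?_
      rw [Nat.mod_pow_succ]
      constructor
      -- As `p < B ^ j`, reducing and dividing by `B ^ j` separates the old digits from the new one.
      · intro h₅
        have hq : 0 < B ^ j := Nat.pow_pos hB
        have e₁ := congrArg (· % B ^ j) h₅
        have e₂ := congrArg (· / B ^ j) h₅
        have e₃ : t % B ^ j < B ^ j := Nat.mod_lt _ hq
        simp only [Nat.add_mul_mod_self_left, Nat.add_mul_mod_self_right, Nat.mod_mod,
          Nat.mod_eq_of_lt hp] at e₁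
        simp only [Nat.add_mul_div_left _ _ hq, Nat.add_mul_div_right _ _ hq,
          Nat.div_eq_of_lt hp, Nat.div_eq_of_lt e₃, zero_add] at e₂
        exact ⟨e₁, e₂⟩
      · rintro ⟨h₅, h₆⟩
        rw [h₅, h₆, mul_comm]
    · rintro _ rfl
      exact (hD' p hpk).fits hS
        (fun i d => (sum_le_sum_of_subset (filter_subset _ _)).trans_lt (hHW d)) fun _ d => hHW d
    · rintro _ rfl
      constructor <;> simp [pickRound, localRound]
    · rintro _ rfl
      rfl
    · rintro _ rfl
      exact hfit _ hltk

end sort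

/-! ### A family of sets that sample well -/

/-- The probability that a random subset of `range n` is `V`, if every element is chosen
independently with probability `p`. -/
noncomputable def weight (n : ℕ) (p : ℝ) (V : Finset ℕ) : ℝ :=
  p ^ V.card * (1 - p) ^ (range n \ V).card

/-- The generating function of a binomial variable: expand the product over `i` of `p * z + (1 - p)`
for `i ∈ N` and of `p + (1 - p)` otherwise. -/
theorem sum_weight_mul_pow {n : ℕ} (p z : ℝ) {N : Finset ℕ} (hN : N ⊆ range n) :
    ∑ V ∈ (range n).powerset, weight n p V * z ^ (N ∩ V).card = (1 + p * (z - 1)) ^ N.card := by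
  have h := prod_add (fun i => p * (if i ∈ N then z else 1)) (fun _ => 1 - p) (range n)
  have h₁ : ∏ i ∈ range n, (p * (if i ∈ N then z else 1) + (1 - p)) =
      (1 + p * (z - 1)) ^ N.card := by
    rw [← prod_subset hN]
    · rw [← prod_const]
      refine prod_congr rfl fun i hi => ?_
      rw [if_pos hi]
      ring
    · intro i _ hi
      rw [if_neg hi]
      ring
  rw [← h₁, h]
  refine sum_congr rfl fun V _ => ?_
  rw [prod_mul_distrib, prod_const, prod_const, ← prod_filter, prod_const, weight,
    filter_mem_eq_inter, inter_comm]
  ring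

/-- `V` contains too many or too few elements of `N`, compared with the expectation `p * #N`. -/
def Bad (p lam : ℝ) (N V : Finset ℕ) : Prop :=
  2 * p * N.card + lam < (N ∩ V).card ∨
    4 * lam ≤ p * N.card ∧ ((N ∩ V).card : ℝ) < p * N.card / 4

open Classical in
-- Chernoff bound: Markov's inequality for `z ^ #(N ∩ V)`, with `z = 2` for the upper tail and `z =
-- 1 / 2` for the lower. Each tail contributes at most `2 ^ (-lam)`.
theorem sum_weight_bad_le {n : ℕ} {p lam : ℝ} (hp₀ : 0 ≤ p) (hp₁ : p ≤ 1) {N : Finset ℕ}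
    (hN : N ⊆ range n) :
    ∑ V ∈ (range n).powerset with Bad p lam N V, weight n p V ≤ 2 * (2 : ℝ) ^ (-lam) := by
  set s : ℝ := (N.card : ℝ) with hs
  have hw : ∀ V, 0 ≤ weight n p V := fun V =>
    mul_nonneg (pow_nonneg hp₀ _) (pow_nonneg (by linarith) _)
  -- These two bounds give `1 + p ≤ 2 ^ (2 * p)` and `1 - p / 2 ≤ 2 ^ (-(p / 2))`.
  have hlog : (1 / 2 : ℝ) ≤ Real.log 2 := by linarith [Real.log_two_gt_d9]
  have hlog' : Real.log 2 ≤ 1 := by linarith [Real.log_two_lt_d9]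
  have h1 : (1 + p * (2 - 1)) ^ N.card ≤ (2 : ℝ) ^ (2 * p * s) := by
    rw [Real.rpow_mul (by norm_num), hs, Real.rpow_natCast]
    refine pow_le_pow_left₀ (by linarith) ?_ _
    rw [Real.rpow_def_of_pos (by norm_num)]
    refine le_trans ?_ (Real.add_one_le_exp _)
    nlinarith
  have h2 : (1 + p * (1 / 2 - 1)) ^ N.card ≤ (2 : ℝ) ^ (-(p / 2) * s) := by
    rw [Real.rpow_mul (by norm_num), hs, Real.rpow_natCast]
    refine pow_le_pow_left₀ (by linarith) ?_ _
    rw [Real.rpow_def_of_pos (by norm_num)]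
    refine le_trans ?_ (Real.add_one_le_exp _)
    nlinarith
  have hpoint : ∀ V, (if Bad p lam N V then weight n p V else 0) ≤
      (2 : ℝ) ^ (-(2 * p * s + lam)) * (weight n p V * 2 ^ (N ∩ V).card) +
      (if 4 * lam ≤ p * s then
        (2 : ℝ) ^ (p * s / 4) * (weight n p V * (1 / 2) ^ (N ∩ V).card) else 0) := by
    intro V
    have hA : 0 ≤ (2 : ℝ) ^ (-(2 * p * s + lam)) * (weight n p V * 2 ^ (N ∩ V).card) :=
      mul_nonneg (by positivity) (mul_nonneg (hw V) (by positivity))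
    have hB : 0 ≤ (2 : ℝ) ^ (p * s / 4) * (weight n p V * (1 / 2) ^ (N ∩ V).card) :=
      mul_nonneg (by positivity) (mul_nonneg (hw V) (by positivity))
    by_cases hbad : Bad p lam N V
    · rw [if_pos hbad]
      rcases hbad with h | ⟨h, h'⟩
      · have h3 : (1 : ℝ) ≤ (2 : ℝ) ^ (-(2 * p * s + lam)) * 2 ^ (N ∩ V).card := by
          rw [← Real.rpow_natCast, ← Real.rpow_add (by norm_num)]
          exact Real.one_le_rpow (by norm_num) (by linarith)
        have h4 := mul_le_mul_of_nonneg_left h3 (hw V)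
        have h5 : 0 ≤ (if 4 * lam ≤ p * s then
          (2 : ℝ) ^ (p * s / 4) * (weight n p V * (1 / 2) ^ (N ∩ V).card) else 0) := by
          split_ifs
          exacts [hB, le_rfl]
        linarith
      · rw [if_pos h]
        have h3 : (1 : ℝ) ≤ (2 : ℝ) ^ (p * s / 4) * (1 / 2) ^ (N ∩ V).card := by
          rw [one_div, inv_pow, ← Real.rpow_natCast, ← Real.rpow_neg (by norm_num),
            ← Real.rpow_add (by norm_num)]
          exact Real.one_le_rpow (by norm_num) (by linarith)
        have h4 := mul_le_mul_of_nonneg_left h3 (hw V)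
        linarith
    · rw [if_neg hbad]
      split_ifs <;> linarith
  rw [sum_filter]
  refine (sum_le_sum fun V _ => hpoint V).trans ?_
  rw [sum_add_distrib, ← mul_sum, sum_weight_mul_pow _ _ hN]
  have h3 : (2 : ℝ) ^ (-(2 * p * s + lam)) * (1 + p * (2 - 1)) ^ N.card ≤ (2 : ℝ) ^ (-lam) := by
    refine (mul_le_mul_of_nonneg_left h1 (by positivity)).trans ?_
    rw [← Real.rpow_add (by norm_num)]
    exact Real.rpow_le_rpow_of_exponent_le (by norm_num) (by linarith)
  have h4 : ∑ V ∈ (range n).powerset, (if 4 * lam ≤ p * s then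
      (2 : ℝ) ^ (p * s / 4) * (weight n p V * (1 / 2) ^ (N ∩ V).card) else 0) ≤
      (2 : ℝ) ^ (-lam) := by
    by_cases h : 4 * lam ≤ p * s
    · simp only [if_pos h]
      rw [← mul_sum, sum_weight_mul_pow _ _ hN]
      refine (mul_le_mul_of_nonneg_left h2 (by positivity)).trans ?_
      rw [← Real.rpow_add (by norm_num)]
      exact Real.rpow_le_rpow_of_exponent_le (by norm_num) (by linarith)
    · simp only [if_neg h, sum_const_zero]
      positivity
  exact (add_le_add h3 (by convert h4)).trans_eq (two_mul _).symm

open Classical in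
-- The members are chosen one after another. A random choice multiplies each summand of the
-- potential by at most `1 + x * q` on average, so some choice does no worse for the whole sum.
theorem exists_sequence {ι Ω : Type*} (I : Finset ι) (O : Finset Ω) (w : Ω → ℝ)
    (hw : ∀ o ∈ O, 0 ≤ w o) (hw₁ : ∑ o ∈ O, w o = 1) (bad : ι → Ω → Prop) {q x : ℝ}
    (hq : ∀ N ∈ I, ∑ o ∈ O with bad N o, w o ≤ q) (hx : 0 ≤ x) (T : ℕ) :
    ∃ F : ℕ → Ω, ∑ N ∈ I, (1 + x) ^ ((range T).filter fun t => bad N (F t)).card ≤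
      I.card * (1 + x * q) ^ T := by
  induction T with
  | zero =>
    obtain ⟨o, -⟩ : O.Nonempty := by
      rw [nonempty_iff_ne_empty]
      rintro rfl
      simp at hw₁
    exact ⟨fun _ => o, by simp⟩
  | succ T ih =>
    obtain ⟨F, hF⟩ := ih
    set a : ι → ℝ := fun N => (1 + x) ^ ((range T).filter fun t => bad N (F t)).card with ha
    have ha0 : ∀ N, 0 ≤ a N := fun N => pow_nonneg (by linarith) _
    have havg : ∑ o ∈ O, w o * ∑ N ∈ I, a N * (1 + if bad N o then x else 0) ≤
        (∑ N ∈ I, a N) * (1 + x * q) := by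
      simp only [mul_sum]
      rw [sum_comm, sum_mul]
      refine sum_le_sum fun N hN => ?_
      have : ∑ o ∈ O, w o * (a N * (1 + if bad N o then x else 0)) =
          a N * (∑ o ∈ O, w o + x * ∑ o ∈ O with bad N o, w o) := by
        rw [sum_filter, mul_sum, ← sum_add_distrib, mul_sum]
        refine sum_congr rfl fun o _ => ?_
        split_ifs <;> ring
      rw [this, hw₁]
      exact mul_le_mul_of_nonneg_left (by linarith [mul_le_mul_of_nonneg_left (hq N hN) hx]) (ha0 N)
    obtain ⟨o, ho⟩ : ∃ o, ∑ N ∈ I, a N * (1 + if bad N o then x else 0) ≤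
        (∑ N ∈ I, a N) * (1 + x * q) := by
      by_contra! hc
      set c := (∑ N ∈ I, a N) * (1 + x * q)
      have h1 : ∑ o ∈ O, w o * (∑ N ∈ I, a N * (1 + if bad N o then x else 0) - c) ≤ 0 := by
        simp only [mul_sub, sum_sub_distrib]
        rw [← sum_mul, hw₁]
        linarith
      have h2 : ∀ o ∈ O, 0 ≤ w o * (∑ N ∈ I, a N * (1 + if bad N o then x else 0) - c) :=
        fun o ho => mul_nonneg (hw o ho) (by linarith [hc o])
      have h3 := (sum_eq_zero_iff_of_nonneg h2).1 (le_antisymm h1 (sum_nonneg h2))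
      have h4 : ∑ o ∈ O, w o = 0 := sum_eq_zero fun o ho => by
        rcases mul_eq_zero.1 (h3 o ho) with h | h
        · exact h
        · linarith [hc o]
      linarith
    refine ⟨Function.update F T o, ?_⟩
    have hstep : ∀ N, (1 + x) ^ ((range (T + 1)).filter fun t =>
        bad N (Function.update F T o t)).card = a N * (1 + if bad N o then x else 0) := by
      intro N
      have h1 : (range T).filter (fun t => bad N (Function.update F T o t)) =
          (range T).filter fun t => bad N (F t) :=
        filter_congr fun t ht => by rw [Function.update_of_ne (mem_range.1 ht).ne]
      rw [range_add_one, filter_insert, h1, Function.update_self]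
      split_ifs with h
      · rw [card_insert_of_notMem (by simp), pow_succ]
      · simp [ha]
    simp only [hstep]
    refine ho.trans ?_
    -- That `q` is nonnegative can be read off only from a member of `I`.
    by_cases hI : I = ∅
    · simp [hI]
    · obtain ⟨N, hN⟩ := nonempty_iff_ne_empty.2 hI
      have hq0 : 0 ≤ q := (sum_nonneg fun o ho => hw o (mem_filter.1 ho).1).trans (hq N hN)
      rw [pow_succ, ← mul_assoc]
      exact mul_le_mul_of_nonneg_right hF (by positivity)

open Classical in
-- Apply `exists_sequence` with `x = n` to all `2 ^ n` subsets. A set with `n` bad indices would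
-- alone contribute `(1 + n) ^ n ≥ 4 ^ n`, while the potential is at most `2 ^ n * exp 1 < 3 * 2 ^
-- n`; `n ≥ 3` makes this impossible.
theorem exists_sampling_family {n T : ℕ} (hn : 3 ≤ n) {p lam : ℝ} (hp₀ : 0 ≤ p)
    (hp₁ : p ≤ 1) (hT : 2 * (2 : ℝ) ^ (-lam) * (n * T) ≤ 1) :
    ∃ F : ℕ → Finset ℕ, ∀ N ⊆ range n, ((range T).filter fun t => Bad p lam N (F t)).card < n := by
  obtain ⟨F, hF⟩ := exists_sequence (range n).powerset (range n).powerset (weight n p)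
    (fun V _ => mul_nonneg (pow_nonneg hp₀ _) (pow_nonneg (by linarith) _))
    (by simpa using sum_weight_mul_pow (n := n) p 1 (empty_subset _)) (Bad p lam)
    (fun N hN => sum_weight_bad_le hp₀ hp₁ (mem_powerset.1 hN)) (Nat.cast_nonneg n) T
  refine ⟨F, fun N hN => ?_⟩
  by_contra! hc
  have h1 : (1 + (n : ℝ)) ^ n ≤ ((range n).powerset.card : ℝ) * (1 + n * (2 * 2 ^ (-lam))) ^ T := by
    refine le_trans ?_ hF
    refine le_trans (pow_le_pow_right₀ (by linarith [Nat.cast_nonneg (α := ℝ) n]) hc) ?_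
    exact single_le_sum (f := fun N => (1 + (n : ℝ)) ^ ((range T).filter fun t =>
      Bad p lam N (F t)).card) (fun _ _ => by positivity) (mem_powerset.2 hN)
  have h2 : (1 + (n : ℝ) * (2 * 2 ^ (-lam))) ^ T ≤ 3 := by
    have h3 : (1 + (n : ℝ) * (2 * 2 ^ (-lam))) ^ T ≤ Real.exp 1 := by
      calc (1 + (n : ℝ) * (2 * 2 ^ (-lam))) ^ T
          ≤ Real.exp ((n : ℝ) * (2 * 2 ^ (-lam))) ^ T := by
            refine pow_le_pow_left₀ (by positivity) ?_ _
            rw [add_comm]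
            exact Real.add_one_le_exp _
        _ = Real.exp (T * ((n : ℝ) * (2 * 2 ^ (-lam)))) := (Real.exp_nat_mul _ _).symm
        _ ≤ Real.exp 1 := Real.exp_le_exp.2 (by linarith)
    linarith [Real.exp_one_lt_d9]
  rw [card_powerset, card_range] at h1
  push_cast at h1
  have hn' : (3 : ℝ) ≤ n := by exact_mod_cast hn
  have h4 : (2 : ℝ) ^ n * 2 ^ n ≤ (1 + n) ^ n := by
    rw [← mul_pow]
    exact pow_le_pow_left₀ (by norm_num) (by linarith) n
  have h5 : (2 : ℝ) ^ 3 ≤ 2 ^ n := pow_le_pow_right₀ (by norm_num) hn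
  nlinarith [mul_le_mul_of_nonneg_left h2 (by positivity : (0 : ℝ) ≤ 2 ^ n)]

/-! ### The degrees after sampling -/

theorem IsSorted.image_eq {L : ℕ} {X : Finset (ℕ × ℕ)} {pos : ℕ × ℕ → ℕ}
    (h : IsSorted M L X pos) : X.image pos = range X.card := by
  refine eq_of_subset_of_card_le (fun a ha => ?_) ?_
  · obtain ⟨e, he, rfl⟩ := mem_image.1 ha
    exact mem_range.2 (h.lt_card e he)
  · rw [card_range, card_image_of_injOn fun e he e' he' => h.inj e he e' he']

/-- The edges at `u` occupy an interval of positions. Take for `a` and `b` the machines of its first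
and last position: a machine strictly between them holds edges at `u` in all its `L` positions, one
outside holds none. -/
theorem IsSorted.pieces {L : ℕ} (hL : 0 < L) {X : Finset (ℕ × ℕ)} {pos : ℕ × ℕ → ℕ}
    (h : IsSorted M L X pos) (u : ℕ) :
    ∃ a b : ℕ, ∀ i, i ≠ a → i ≠ b → (X.filter fun e => pos e / L = i ∧ e.1 = u) = ∅ ∨
      L ≤ (X.filter fun e => pos e / L = i ∧ e.1 = u).card := by
  rcases (X.filter fun e => e.1 = u).eq_empty_or_nonempty with h₀ | h₀
  · refine ⟨0, 0, fun i _ _ => Or.inl ?_⟩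
    rw [filter_eq_empty_iff] at h₀ ⊢
    exact fun e he he' => h₀ he he'.2
  obtain ⟨e₁, he₁, hmin⟩ := exists_min_image _ pos h₀
  obtain ⟨e₂, he₂, hmax⟩ := exists_max_image _ pos h₀
  rw [mem_filter] at he₁ he₂
  refine ⟨pos e₁ / L, pos e₂ / L, fun i hi₁ hi₂ => ?_⟩
  rcases (X.filter fun e => pos e / L = i ∧ e.1 = u).eq_empty_or_nonempty with h₁ | ⟨e, he⟩
  · exact Or.inl h₁
  right
  rw [mem_filter] at he
  have hlo : pos e₁ / L ≤ i := by
    rw [← he.2.1]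
    exact Nat.div_le_div_right (hmin e (mem_filter.2 ⟨he.1, he.2.2⟩))
  have hhi : i ≤ pos e₂ / L := by
    rw [← he.2.1]
    exact Nat.div_le_div_right (hmax e (mem_filter.2 ⟨he.1, he.2.2⟩))
  have hlo' : pos e₁ < i * L := (Nat.div_lt_iff_lt_mul hL).1 (lt_of_le_of_ne hlo (Ne.symm hi₁))
  have hhi' : (i + 1) * L ≤ pos e₂ := (Nat.le_div_iff_mul_le hL).1 (lt_of_le_of_ne hhi hi₂)
  rw [add_mul, one_mul] at hhi'
  -- Sorted positions have no gaps, and an edge placed between two edges at `u` has first endpoint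
  -- `u`.
  have hsub : Ico (i * L) (i * L + L) ⊆ (X.filter fun e => pos e / L = i ∧ e.1 = u).image pos := by
    intro a ha
    rw [mem_Ico] at ha
    have haX : a ∈ X.image pos := by
      rw [h.image_eq, mem_range]
      have := h.lt_card e₂ he₂.1
      omega
    obtain ⟨e', he', rfl⟩ := mem_image.1 haX
    refine mem_image.2 ⟨e', mem_filter.2 ⟨he', ?_, ?_⟩, rfl⟩
    · rw [Nat.div_eq_iff hL]
      omega
    · rcases lt_trichotomy e'.1 u with h' | h' | h'
      · have := h.mono e' he' e₁ he₁.1 (he₁.2.symm ▸ h')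
        omega
      · exact h'
      · have := h.mono e₂ he₂.1 e' he' (he₂.2.symm ▸ h')
        omega
  calc L = (Ico (i * L) (i * L + L)).card := by simp
    _ ≤ _ := card_le_card hsub
    _ ≤ _ := card_image_le

/-- The neighbours of `u` in a set of edges. -/
def nbrs (X : Finset (ℕ × ℕ)) (u : ℕ) : Finset ℕ := (X.filter fun e => e.1 = u).image Prod.snd

theorem card_image_snd {X : Finset (ℕ × ℕ)} {u : ℕ} (h : ∀ e ∈ X, e.1 = u) :
    (X.image Prod.snd).card = X.card :=
  card_image_of_injOn fun e he e' he' hh => Prod.ext ((h e he).trans (h e' he').symm) hh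

theorem card_nbrs (X : Finset (ℕ × ℕ)) (u : ℕ) :
    (nbrs X u).card = (X.filter fun e => e.1 = u).card :=
  card_image_snd fun _ he => (mem_filter.1 he).2

/-- The neighbours of `u` that are known to a machine with the tokens `D`. -/
def piece (D : Finset (ℕ × ℕ × ℕ)) (u : ℕ) : Finset ℕ :=
  (D.filter fun x => x.2.1 = u).image fun x => x.2.2

theorem piece_tokensAt {L : ℕ} {X : Finset (ℕ × ℕ)} {pos : ℕ × ℕ → ℕ} {i u : ℕ} :
    piece (tokensAt L X pos i) u =
      (X.filter fun e => pos e / L = i ∧ e.1 = u).image Prod.snd := by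
  ext v
  simp only [piece, mem_image, mem_filter, mem_tokensAt]
  constructor
  · rintro ⟨x, ⟨⟨h₁, h₂, h₃⟩, h₄⟩, h₅⟩
    exact ⟨x.2, ⟨h₁, h₂ ▸ h₃, h₄⟩, h₅⟩
  · rintro ⟨e, ⟨h₁, h₂, h₃⟩, h₄⟩
    exact ⟨(pos e, e), ⟨⟨h₁, rfl, h₂⟩, h₃⟩, h₄⟩

theorem card_piece_inter {L : ℕ} {X : Finset (ℕ × ℕ)} {pos : ℕ × ℕ → ℕ} {i u : ℕ}
    (F : Finset ℕ) : (piece (tokensAt L X pos i) u ∩ F).card =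
      (X.filter fun e => pos e / L = i ∧ e.1 = u ∧ e.2 ∈ F).card := by
  rw [piece_tokensAt,
    ← card_image_snd (u := u) (X := X.filter _) fun e he => (mem_filter.1 he).2.2.1]
  congr 1
  ext v
  simp only [mem_inter, mem_image, mem_filter]
  constructor
  · rintro ⟨⟨e, ⟨h₁, h₂, h₃⟩, rfl⟩, h₄⟩
    exact ⟨e, ⟨h₁, h₂, h₃, h₄⟩, rfl⟩
  · rintro ⟨e, ⟨h₁, h₂, h₃, h₄⟩, rfl⟩
    exact ⟨⟨e, ⟨h₁, h₂, h₃⟩, rfl⟩, h₄⟩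

open Classical in
/-- The number of nodes whose neighbours on a machine with the tokens `D` are badly sampled. -/
noncomputable def cost (p lam : ℝ) (F : ℕ → Finset ℕ) (D : Finset (ℕ × ℕ × ℕ)) (t : ℕ) : ℕ :=
  ((D.image fun x => x.2.1).filter fun u => Bad p lam (piece D u) (F t)).card

theorem not_bad_of_cost_eq_zero {p lam : ℝ} {F : ℕ → Finset ℕ} {D : Finset (ℕ × ℕ × ℕ)} {t u : ℕ}
    (h : cost p lam F D t = 0) (hu : (piece D u).Nonempty) : ¬ Bad p lam (piece D u) (F t) := by
  classical
  rw [cost, card_eq_zero, filter_eq_empty_iff] at h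
  obtain ⟨v, hv⟩ := hu
  obtain ⟨x, hx, -⟩ := mem_image.1 hv
  exact h (mem_image.2 ⟨x, mem_filter.1 hx⟩)

open Classical in
theorem sum_cost_le {p lam : ℝ} {F : ℕ → Finset ℕ} {D : Finset (ℕ × ℕ × ℕ)} {n T : ℕ}
    (hF : ∀ N ⊆ range n, ((range T).filter fun t => Bad p lam N (F t)).card ≤ n)
    (hD : ∀ x ∈ D, x.2.2 < n) : ∑ t ∈ range T, cost p lam F D t ≤ D.card * n := by
  simp only [cost, card_filter]
  rw [sum_comm]
  simp only [← card_filter]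
  calc _ ≤ ∑ _u ∈ D.image fun x => x.2.1, n := sum_le_sum fun u _ => hF _ fun v hv => by
        obtain ⟨x, hx, rfl⟩ := mem_image.1 hv
        exact mem_range.2 (hD x (mem_filter.1 hx).1)
    _ = (D.image fun x => x.2.1).card * n := by rw [sum_const, smul_eq_mul]
    _ ≤ D.card * n := Nat.mul_le_mul_right _ card_image_le

theorem sum_card_tokensAt {L : ℕ} {X : Finset (ℕ × ℕ)} {pos : ℕ × ℕ → ℕ}
    (h : IsPlacement M L X pos) (q : ℕ × ℕ → Prop) [DecidablePred q] :
    ∑ i : Fin M, (X.filter fun e => pos e / L = i ∧ q e).card = (X.filter q).card := by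
  rw [sum_card_filter_fin]
  congr 1
  exact filter_congr fun e he =>
    and_iff_right ⟨⟨pos e / L, div_lt_of_placement h he⟩, mem_univ _, rfl⟩

open Classical in
-- There are at most as many pieces as edges, and each is bad for at most `n` indices. With at most
-- `n ^ 2` edges the average cost is below 1 as soon as `T > n ^ 3`, which is what `select_triple`
-- needs.
theorem sum_sum_cost_le {p lam : ℝ} {F : ℕ → Finset ℕ} {L n T : ℕ} {X : Finset (ℕ × ℕ)}
    {pos : ℕ × ℕ → ℕ} (h : IsPlacement M L X pos)
    (hF : ∀ N ⊆ range n, ((range T).filter fun t => Bad p lam N (F t)).card ≤ n)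
    (hX : ∀ e ∈ X, e.2 < n) :
    ∑ t ∈ range T, ∑ i : Fin M, cost p lam F (tokensAt L X pos i) t ≤ X.card * n := by
  rw [sum_comm]
  have hc : ∀ i : Fin M, (tokensAt L X pos i).card =
      (X.filter fun e => pos e / L = i ∧ True).card := fun i => by
    rw [← card_filter_tokensAt (q := fun _ => True), filter_true]
  calc _ ≤ ∑ i : Fin M, (tokensAt L X pos i).card * n :=
        sum_le_sum fun i _ => sum_cost_le hF fun x hx => hX _ (mem_tokensAt.1 hx).1
    _ = X.card * n := by
      rw [← sum_mul, sum_congr rfl fun i _ => hc i, sum_card_tokensAt h, filter_true]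

/-- Sum over the machines. A piece of expected sample size at least `4 * lam` obeys purely
multiplicative bounds, since `lam` is absorbed into `p * c`. By `hpL` a smaller nonempty piece
cannot fill a machine, so it lies on `a` or `b`. -/
theorem IsSorted.degree_bounds {L : ℕ} (hL : 0 < L) {X : Finset (ℕ × ℕ)} {pos : ℕ × ℕ → ℕ}
    (h : IsSorted M L X pos) {p lam : ℝ} (hp : 0 ≤ p) (hlam : 0 ≤ lam) (hpL : 4 * lam ≤ p * L)
    {F : ℕ → Finset ℕ} {t : ℕ}
    (hcost : ∀ i : Fin M, cost p lam F (tokensAt L X pos i) t = 0) (u : ℕ) :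
    p * (nbrs X u).card / 4 - 2 * lam ≤ (nbrs (X.filter fun e => e.2 ∈ F t) u).card ∧
      ((nbrs (X.filter fun e => e.2 ∈ F t) u).card : ℝ) ≤
        3 * p * (nbrs X u).card + 2 * lam := by
  obtain ⟨a, b, hab⟩ := h.pieces hL u
  set c : ℕ → ℕ := fun i => (X.filter fun e => pos e / L = i ∧ e.1 = u).card with hc
  set c' : ℕ → ℕ := fun i => (X.filter fun e => pos e / L = i ∧ e.1 = u ∧ e.2 ∈ F t).card with hc'
  have h₁ : (nbrs X u).card = ∑ i : Fin M, c i := by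
    rw [card_nbrs, sum_card_tokensAt h.toIsPlacement]
  have h₂ : (nbrs (X.filter fun e => e.2 ∈ F t) u).card = ∑ i : Fin M, c' i := by
    rw [card_nbrs, sum_card_tokensAt h.toIsPlacement, filter_filter]
    simp only [and_comm]
  -- The additive error granted to machine `i`: `lam` for each of the two exceptional machines.
  set x : ℕ → ℝ := fun i => (if i = a then lam else 0) + if i = b then lam else 0 with hx
  have hsum : ∑ i : Fin M, x i ≤ 2 * lam := by
    have h₀ : ∀ y : ℕ, ∑ i : Fin M, (if (i : ℕ) = y then lam else 0) ≤ lam := by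
      intro y
      rw [Fin.sum_univ_eq_sum_range (fun i => if i = y then lam else 0), sum_ite_eq']
      split_ifs
      exacts [le_rfl, hlam]
    rw [hx, sum_add_distrib]
    linarith [h₀ a, h₀ b]
  have hi : ∀ i : Fin M, p * c i / 4 - x i ≤ c' i ∧ (c' i : ℝ) ≤ 3 * p * c i + x i := by
    intro i
    have hx0 : 0 ≤ x i := by
      simp only [hx]
      split_ifs <;> linarith
    rcases Nat.eq_zero_or_pos (c i) with h₀ | h₀
    · have h₃ : c' i ≤ c i := card_le_card fun e he => by
        rw [mem_filter] at he ⊢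
        exact ⟨he.1, he.2.1, he.2.2.1⟩
      have h₄ : c' i = 0 := by omega
      rw [h₀, h₄]
      simp only [Nat.cast_zero]
      constructor <;> linarith
    · have hci : (piece (tokensAt L X pos i) u).card = c i := by
        rw [piece_tokensAt]
        exact card_image_snd fun e he => (mem_filter.1 he).2.2
      have hb := not_bad_of_cost_eq_zero (hcost i) (u := u) (card_pos.1 (hci ▸ h₀))
      rw [Bad, hci, card_piece_inter] at hb
      change ¬ (2 * p * c i + lam < c' i ∨ 4 * lam ≤ p * c i ∧ (c' i : ℝ) < p * c i / 4) at hb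
      push Not at hb
      obtain ⟨hb₁, hb₂⟩ := hb
      have hpc : 0 ≤ p * c i := mul_nonneg hp (Nat.cast_nonneg _)
      have hc0 : (0 : ℝ) ≤ c' i := Nat.cast_nonneg _
      by_cases hlarge : 4 * lam ≤ p * c i
      · have := hb₂ hlarge
        constructor <;> linarith
      · have hxl : lam ≤ x i := by
          by_cases ha : (i : ℕ) = a
          · simp only [hx, if_pos ha]
            split_ifs
            all_goals linarith
          by_cases hb : (i : ℕ) = b
          · simp only [hx, if_neg ha, if_pos hb]
            linarith
          exfalso
          rcases hab i ha hb with h₅ | h₅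
          · have : c i = 0 := card_eq_zero.2 h₅
            omega
          · have h₆ : (L : ℝ) ≤ c i := by exact_mod_cast h₅
            linarith [mul_le_mul_of_nonneg_left h₆ hp]
        constructor <;> linarith
  rw [h₁, h₂]
  push_cast
  constructor
  · have := sum_le_sum fun i (_ : i ∈ (univ : Finset (Fin M))) => (hi i).1
    rw [sum_sub_distrib, ← sum_div, ← mul_sum] at this
    linarith
  · have := sum_le_sum fun i (_ : i ∈ (univ : Finset (Fin M))) => (hi i).2
    rw [sum_add_distrib, ← mul_sum] at this
    linarith

/-- Allows a placement known only to exist to be fixed before the next rounds are analysed. -/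
theorem Triple.of_forall_eq {S W : ℕ} {P Q : (Fin M → LocalState B) → Prop}
    {Rs : List (Round M B)} (h : ∀ X, P X → Triple S W (· = X) Rs Q) : Triple S W P Rs Q :=
  fun X hX => h X hX X rfl

/-! ### One stage of the sparsification -/

section stage
variable [NeZero B]

/-- The edges `(u, v)` such that `v` belongs to the selected set are kept. -/
def keepRound (F : ℕ → Finset ℕ) : Round M B := localRound fun s : LocalState B =>
  { toks := s.toks.filter fun x => x.2.2 ∈ F s.ctr
    pre := 0
    tot := 0
    ctr := 0 }

/-- The rounds that select a set from the family `F` and remove the edges outside of it. -/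
noncomputable def stage (b h k L : ℕ) (p lam : ℝ) (F : ℕ → Finset ℕ) : List (Round M B) :=
  sort b h k L ++ (select b h k (cost p lam F) ++ [keepRound F])

theorem tokensAt_filter {L : ℕ} {X : Finset (ℕ × ℕ)} {pos : ℕ × ℕ → ℕ} {i : ℕ} (V : Finset ℕ) :
    (tokensAt L X pos i).filter (fun x => x.2.2 ∈ V) =
      tokensAt L (X.filter fun e => e.2 ∈ V) pos i := by
  ext x
  simp only [mem_filter, mem_tokensAt]
  tauto

open Classical in
theorem stage_triple {b h k n S L W : ℕ} (hM : M = b ^ h) (hb : 0 < b) (hL : 0 < L)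
    (hS : 1 + 2 * B + L ≤ S) (hbB : b * B ≤ S) (hk : 0 < k) {X : Finset (ℕ × ℕ)}
    (hX₁ : ∀ e ∈ X, e.1 < B ^ k) (hX₂ : ∀ e ∈ X, e.2 < n) (hXn : X.card * n < B ^ k)
    (hXW : X.card < W) (hBW : B ^ k ≤ W) (hW : ∀ a < M * L, ∀ e ∈ X, code (a, e) < W)
    {p lam : ℝ} (hp : 0 ≤ p) (hlam : 0 ≤ lam) (hpL : 4 * lam ≤ p * L) {F : ℕ → Finset ℕ}
    (hF : ∀ N ⊆ range n, ((range (B ^ k)).filter fun t => Bad p lam N (F t)).card ≤ n) :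
    Triple (M := M) (B := B) S W (fun Y => ∃ pos, IsPlacement M L X pos ∧ Y = placed M B L X pos 0)
      (stage b h k L p lam F)
      (fun Y => ∃ V : Finset ℕ, (∃ pos, IsPlacement M L (X.filter fun e => e.2 ∈ V) pos ∧
          Y = placed M B L (X.filter fun e => e.2 ∈ V) pos 0) ∧
        ∀ u, p * (nbrs X u).card / 4 - 2 * lam ≤ (nbrs (X.filter fun e => e.2 ∈ V) u).card ∧
          ((nbrs (X.filter fun e => e.2 ∈ V) u).card : ℝ) ≤
            3 * p * (nbrs X u).card + 2 * lam) := by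
  have hW0 : 0 < W := by omega
  refine (sort_triple hM hb hL hS hbB hk hX₁ hW hW0 hXW).append
    (Triple.of_forall_eq ?_)
  rintro Y ⟨pos, hpos, rfl⟩
  have hfit := hpos.toIsPlacement.tokensFit hL hW hW0
  have hfilter : ∀ V : Finset ℕ, ∀ i, Fits S W
      (placed M B L (X.filter fun e => e.2 ∈ V) pos 0 i) := fun V =>
    (hpos.toIsPlacement.mono (filter_subset _ _)).fits hL
      (fun a ha e he => hW a ha e (mem_filter.1 he).1) hW0 hS
  refine (select_triple hM hb hS hbB hfit (cost p lam F) hBW ?_).append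
    (localRound_triple ?_ ?_ ?_)
  · exact (sum_sum_cost_le hpos.toIsPlacement hF hX₂).trans_lt hXn
  · rintro _ ⟨q, hq, rfl, -⟩
    exact (hpos.toIsPlacement.tokensFit hL hW (hq.trans_le hBW)).fits hS (fun _ _ => hW0)
      fun _ _ => hW0
  · rintro Y ⟨V, ⟨pos', hpos', rfl⟩, -⟩
    exact hpos'.fits hL (fun a ha e he => hW a ha e (mem_filter.1 he).1) hW0 hS
  · rintro _ ⟨q, hq, rfl, hcost⟩
    refine ⟨F q, ⟨pos, hpos.toIsPlacement.mono (filter_subset _ _), ?_⟩,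
      fun u => hpos.degree_bounds hL hp hlam hpL hcost u⟩
    funext i
    simp only [placed, mkState, ← tokensAt_filter]
    rfl

/-- The rounds of the sparsification. -/
noncomputable def sparsify (r b h k L : ℕ) (p lam : ℝ) (F : ℕ → Finset ℕ) : List (Round M B) :=
  (List.range r).flatMap fun _ => stage b h k L p lam F

open Classical in
-- The invariant after `s` stages is that degrees lie in `[lo * (p / 8) ^ s, hi * (4 * p) ^ s]`. By
-- `hlo'` the expected degree `p * d` is always at least `16 * lam`, so the error `2 * lam` is at
-- most `p * d / 8` and the factors `1 / 4` and `3` only worsen to `1 / 8` and `4`.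
theorem sparsify_triple {r b h k n S L W : ℕ} (hM : M = b ^ h) (hb : 0 < b) (hL : 0 < L)
    (hS : 1 + 2 * B + L ≤ S) (hbB : b * B ≤ S) (hk : 0 < k) {X : Finset (ℕ × ℕ)}
    (hX₁ : ∀ e ∈ X, e.1 < B ^ k) (hX₂ : ∀ e ∈ X, e.2 < n) (hXn : X.card * n < B ^ k)
    (hXW : X.card < W) (hBW : B ^ k ≤ W) (hW : ∀ a < M * L, ∀ e ∈ X, code (a, e) < W)
    {p lam : ℝ} (hp : 0 ≤ p) (hp₁ : p ≤ 1) (hlam : 0 ≤ lam) (hpL : 4 * lam ≤ p * L)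
    {F : ℕ → Finset ℕ}
    (hF : ∀ N ⊆ range n, ((range (B ^ k)).filter fun t => Bad p lam N (F t)).card ≤ n)
    {U : Finset ℕ} {lo hi : ℝ} (hlo : 0 ≤ lo) (hlo' : 16 * lam ≤ lo * (p / 8) ^ r)
    (hU : ∀ u ∈ U, lo ≤ (nbrs X u).card ∧ ((nbrs X u).card : ℝ) ≤ hi) :
    Triple (M := M) (B := B) S W (fun Y => ∃ pos, IsPlacement M L X pos ∧ Y = placed M B L X pos 0)
      (sparsify r b h k L p lam F)
      (fun Y => ∃ V : Finset ℕ, (∃ pos, IsPlacement M L (X.filter fun e => e.2 ∈ V) pos ∧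
          Y = placed M B L (X.filter fun e => e.2 ∈ V) pos 0) ∧
        ∀ u ∈ U, lo * (p / 8) ^ r ≤ (nbrs (X.filter fun e => e.2 ∈ V) u).card ∧
          ((nbrs (X.filter fun e => e.2 ∈ V) u).card : ℝ) ≤ hi * (4 * p) ^ r) := by
  have hW0 : 0 < W := by omega
  have key := Triple.loop (S := S) (W := W)
    (I := fun s (Y : Fin M → LocalState B) => ∃ V : Finset ℕ,
        (∃ pos, IsPlacement M L (X.filter fun e => e.2 ∈ V) pos ∧
          Y = placed M B L (X.filter fun e => e.2 ∈ V) pos 0) ∧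
        ∀ u ∈ U, lo * (p / 8) ^ s ≤ (nbrs (X.filter fun e => e.2 ∈ V) u).card ∧
          ((nbrs (X.filter fun e => e.2 ∈ V) u).card : ℝ) ≤ hi * (4 * p) ^ s)
    (body := fun _ => stage b h k L p lam F) r ?_ ?_
  · refine key.mono ?_ fun _ hY => hY
    rintro _ ⟨pos, hpos, rfl⟩
    have hf : (X.filter fun e => e.2 ∈ range n) = X :=
      filter_true_of_mem fun e he => mem_range.2 (hX₂ e he)
    exact ⟨range n, by rw [hf]; exact ⟨pos, hpos, rfl⟩, by rw [hf]; simpa using hU⟩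
  · rintro _ ⟨V, ⟨pos, hpos, rfl⟩, -⟩
    exact hpos.fits hL (fun a ha e he => hW a ha e (mem_filter.1 he).1) hW0 hS
  · rintro s hs Y ⟨V, hY, hdeg⟩
    have hsub : (X.filter fun e => e.2 ∈ V) ⊆ X := filter_subset _ _
    have hcard := card_le_card hsub
    obtain ⟨hv, V', hY', hdeg'⟩ := stage_triple hM hb hL hS hbB hk (fun e he => hX₁ e (hsub he))
      (fun e he => hX₂ e (hsub he)) ((Nat.mul_le_mul_right _ hcard).trans_lt hXn)
      (hcard.trans_lt hXW) hBW (fun a ha e he => hW a ha e (hsub he)) hp hlam hpL hF Y hY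
    have hff : ((X.filter fun e => e.2 ∈ V).filter fun e => e.2 ∈ V') =
        X.filter fun e => e.2 ∈ V ∩ V' := by
      simp only [filter_filter, mem_inter]
    rw [hff] at hY' hdeg'
    refine ⟨hv, V ∩ V', hY', fun u hu => ?_⟩
    obtain ⟨h₁, h₂⟩ := hdeg u hu
    obtain ⟨h₃, h₄⟩ := hdeg' u
    set d : ℝ := ((nbrs (X.filter fun e => e.2 ∈ V) u).card : ℝ) with hd
    have h₅ : p * (lo * (p / 8) ^ s) ≤ p * d := mul_le_mul_of_nonneg_left h₁ hp
    have h₆ : p * d ≤ p * (hi * (4 * p) ^ s) := mul_le_mul_of_nonneg_left h₂ hp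
    -- The lower bound decreases with every stage because `p ≤ 1`, so the condition on the last
    -- stage covers all.
    have h₇ : lo * (p / 8) ^ r ≤ lo * (p / 8) ^ (s + 1) :=
      mul_le_mul_of_nonneg_left (pow_le_pow_of_le_one (by linarith) (by linarith) hs) hlo
    have h₈ : 0 ≤ lo * (p / 8) ^ (s + 1) := by positivity
    have e₁ : lo * (p / 8) ^ (s + 1) = p * (lo * (p / 8) ^ s) / 8 := by ring
    have e₂ : hi * (4 * p) ^ (s + 1) = 4 * (p * (hi * (4 * p) ^ s)) := by ring
    rw [e₂]
    constructor <;> linarith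

end stage

/-! ### The input and the output -/

theorem length_edgeWords {n : ℕ} (l : List (Fin n × Fin n)) :
    (edgeWords l).length = 2 * l.length := by
  induction l with
  | nil => rfl
  | cons e l ih =>
    simp only [edgeWords, List.flatMap_cons, List.length_append, List.length_cons,
      List.length_nil] at ih ⊢
    omega

theorem getD_edgeWords {n : ℕ} {l : List (Fin n × Fin n)} {a : ℕ} {e : Fin n × Fin n}
    (h : l[a]? = some e) :
    (edgeWords l).getD (2 * a) 0 = e.1 ∧ (edgeWords l).getD (2 * a + 1) 0 = e.2 := by
  induction l generalizing a with
  | nil => simp at h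
  | cons e' l ih =>
    cases a with
    | zero =>
      simp only [List.getElem?_cons_zero, Option.some.injEq] at h
      subst h
      simp [edgeWords]
    | succ a =>
      have := ih (by simpa using h)
      simpa [edgeWords, mul_add] using this

theorem lt_of_mem_edgeWords {n : ℕ} {l : List (Fin n × Fin n)} {w : ℕ} (h : w ∈ edgeWords l) :
    w < n := by
  simp only [edgeWords, List.mem_flatMap, List.mem_cons, List.not_mem_nil, or_false] at h
  obtain ⟨e, -, rfl | rfl⟩ := h
  exacts [e.1.2, e.2.2]

theorem mem_load {n L : ℕ} {i : Fin M} {l : List (Fin n × Fin n)} {x : ℕ × ℕ × ℕ} :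
    x ∈ (load (B := B) L i (edgeWords l)).toks ↔
      ∃ (a : ℕ) (e : Fin n × Fin n), l[a]? = some e ∧ x = (i * L + a, (e.1 : ℕ), (e.2 : ℕ)) := by
  simp only [load, mem_image, mem_range, length_edgeWords,
    Nat.mul_div_cancel_left _ (by norm_num : 0 < 2)]
  constructor
  · rintro ⟨a, ha, rfl⟩
    have h : l[a]? = some l[a] := List.getElem?_eq_getElem ha
    exact ⟨a, _, h, by rw [(getD_edgeWords h).1, (getD_edgeWords h).2]⟩
  · rintro ⟨a, e, h, rfl⟩
    exact ⟨a, (List.getElem?_eq_some_iff.1 h).1,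
      by rw [(getD_edgeWords h).1, (getD_edgeWords h).2]⟩

/-- The edges of a graph as pairs of numbers, with the endpoint in `U` first. -/
def edgePairs {n : ℕ} (G : SimpleGraph (Fin n)) [DecidableRel G.Adj] (U : Finset (Fin n)) :
    Finset (ℕ × ℕ) :=
  (univ.filter fun e : Fin n × Fin n => e.1 ∈ U ∧ G.Adj e.1 e.2).image fun e =>
    ((e.1 : ℕ), (e.2 : ℕ))

theorem slot_unique {n L : ℕ} {G : SimpleGraph (Fin n)} {U : Finset (Fin n)}
    {E : Fin M → List (Fin n × Fin n)} (hE : IsEdgeDistribution G U M L E) {i i' : Fin M} {a a' : ℕ}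
    {e : Fin n × Fin n} (h : (E i)[a]? = some e) (h' : (E i')[a']? = some e) :
    i = i' ∧ a = a' := by
  have hcount : ∀ {j : Fin M} {c : ℕ}, (E j)[c]? = some e → 1 ≤ (E j).count e := fun hc =>
    List.count_pos_iff.2 (List.mem_of_getElem? hc)
  have hi : i = i' := by
    by_contra hne
    have h₁ : ∑ j ∈ {i, i'}, (E j).count e ≤ ∑ j, (E j).count e :=
      sum_le_sum_of_subset (subset_univ _)
    rw [sum_pair hne] at h₁
    have := hE.once e
    have := hcount h
    have := hcount h'
    omega
  subst hi
  refine ⟨rfl, ?_⟩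
  have hnd : (E i).Nodup := List.nodup_iff_count_le_one.2 fun f =>
    (single_le_sum (f := fun j => (E j).count f) (fun _ _ => Nat.zero_le _)
      (mem_univ i)).trans (hE.once f)
  obtain ⟨ha, rfl⟩ := List.getElem?_eq_some_iff.1 h
  obtain ⟨ha', he⟩ := List.getElem?_eq_some_iff.1 h'
  exact (hnd.getElem_inj_iff.1 he).symm

section input
variable {n L : ℕ} {G : SimpleGraph (Fin n)} [DecidableRel G.Adj] {U : Finset (Fin n)}
  {E : Fin M → List (Fin n × Fin n)}

theorem mem_edgePairs {u v : Fin n} :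
    ((u : ℕ), (v : ℕ)) ∈ edgePairs G U ↔ u ∈ U ∧ G.Adj u v := by
  simp only [edgePairs, mem_image, mem_filter, mem_univ, true_and, Prod.mk.injEq, Fin.val_inj]
  constructor
  · rintro ⟨e, h, rfl, rfl⟩
    exact h
  · exact fun h => ⟨(u, v), h, rfl, rfl⟩

theorem exists_of_mem_edgePairs {e : ℕ × ℕ} (h : e ∈ edgePairs G U) :
    ∃ u v : Fin n, e = ((u : ℕ), (v : ℕ)) ∧ u ∈ U ∧ G.Adj u v := by
  obtain ⟨f, hf, rfl⟩ := mem_image.1 h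
  exact ⟨f.1, f.2, rfl, (mem_filter.1 hf).2⟩

/-- Slot `a` of machine `i` is position `i * L + a`; an edge has only one slot by `slot_unique`.
Pairs that are not edges get the dummy position 0. -/
theorem load_eq_placed (hE : IsEdgeDistribution G U M L E) :
    ∃ pos, IsPlacement M L (edgePairs G U) pos ∧
      (fun i => load L i (edgeWords (E i))) = placed M B L (edgePairs G U) pos 0 := by
  have hex : ∀ e : ℕ × ℕ, ∃ q : ℕ, e ∈ edgePairs G U → ∃ (i : Fin M) (a : ℕ) (f : Fin n × Fin n),
      (E i)[a]? = some f ∧ e = ((f.1 : ℕ), (f.2 : ℕ)) ∧ q = i * L + a := by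
    intro e
    by_cases he : e ∈ edgePairs G U
    · obtain ⟨u, v, rfl, huv⟩ := exists_of_mem_edgePairs he
      obtain ⟨i, hi⟩ := (hE.mem_iff u v).2 huv
      obtain ⟨a, ha⟩ := List.mem_iff_getElem?.1 hi
      exact ⟨i * L + a, fun _ => ⟨i, a, _, ha, rfl, rfl⟩⟩
    · exact ⟨0, fun h => absurd h he⟩
  choose pos hpos using hex
  have hlt : ∀ {i : Fin M} {a : ℕ} {f : Fin n × Fin n}, (E i)[a]? = some f → a < L := fun h =>
    (List.getElem?_eq_some_iff.1 h).1.trans_le (hE.load _)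
  have hdiv : ∀ {i : Fin M} {a : ℕ} {f : Fin n × Fin n}, (E i)[a]? = some f →
      ((i : ℕ) * L + a) / L = i ∧ ((i : ℕ) * L + a) % L = a := fun {i a f} h => by
    have h₁ := hlt h
    constructor
    · rw [add_comm, Nat.add_mul_div_right _ _ (by omega), Nat.div_eq_of_lt h₁, zero_add]
    · rw [add_comm, Nat.add_mul_mod_self_right, Nat.mod_eq_of_lt h₁]
  refine ⟨pos, ⟨fun e he e' he' h => ?_, fun e he => ?_⟩, ?_⟩
  · obtain ⟨i, a, f, h₁, rfl, h₂⟩ := hpos e he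
    obtain ⟨i', a', f', h₁', rfl, h₂'⟩ := hpos e' he'
    have h₃ : (i : ℕ) * L + a = i' * L + a' := by rw [← h₂, ← h₂', h]
    have h₄ : i = i' := Fin.ext (by rw [← (hdiv h₁).1, ← (hdiv h₁').1, h₃])
    have h₅ : a = a' := by rw [← (hdiv h₁).2, ← (hdiv h₁').2, h₃]
    subst h₄ h₅
    rw [h₁, Option.some.injEq] at h₁'
    rw [h₁']
  · obtain ⟨i, a, f, h₁, rfl, h₂⟩ := hpos e he
    rw [h₂]
    have h₃ := Nat.mul_le_mul_right L (show (i : ℕ) + 1 ≤ M from i.2)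
    have h₄ := hlt h₁
    rw [add_mul] at h₃
    omega
  · funext i
    apply LocalState.ext
    · ext x
      rw [mem_load]
      simp only [placed, mkState, mem_tokensAt]
      constructor
      · rintro ⟨a, f, h, rfl⟩
        have he : ((f.1 : ℕ), (f.2 : ℕ)) ∈ edgePairs G U :=
          mem_edgePairs.2 ((hE.mem_iff _ _).1 ⟨i, List.mem_of_getElem? h⟩)
        obtain ⟨i', a', f', h₁, h₂, h₃⟩ := hpos _ he
        have h₄ : f = f' := by
          simp only [Prod.mk.injEq, Fin.val_inj] at h₂
          exact Prod.ext h₂.1 h₂.2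
        subst h₄
        obtain ⟨rfl, rfl⟩ := slot_unique hE h h₁
        exact ⟨he, h₃.symm, (hdiv h).1⟩
      · rintro ⟨h₁, h₂, h₃⟩
        obtain ⟨i', a, f, h₄, h₅, h₆⟩ := hpos _ h₁
        have h₇ : i' = i := by
          apply Fin.ext
          rw [← h₃, h₂, h₆, (hdiv h₄).1]
        subst h₇
        exact ⟨a, f, h₄, Prod.ext (h₂.trans h₆) h₅⟩
    · rfl
    · rfl
    · rfl

theorem card_nbrs_edgePairs {u : Fin n} (hu : u ∈ U) :
    (nbrs (edgePairs G U) u).card = G.degree u := by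
  have : nbrs (edgePairs G U) u = (G.neighborFinset u).map Fin.valEmbedding := by
    ext w
    simp only [nbrs, mem_image, mem_filter, mem_map, SimpleGraph.mem_neighborFinset,
      Fin.valEmbedding_apply]
    constructor
    · rintro ⟨e, ⟨he, h₁⟩, rfl⟩
      obtain ⟨u', v, rfl, -, h₂⟩ := exists_of_mem_edgePairs he
      obtain rfl : u' = u := Fin.ext h₁
      exact ⟨v, h₂, rfl⟩
    · rintro ⟨v, hv, rfl⟩
      exact ⟨(u, v), ⟨mem_edgePairs.2 ⟨hu, hv⟩, rfl⟩, rfl⟩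
  rw [this, card_map, SimpleGraph.card_neighborFinset_eq_degree]

theorem program_correct {S W : ℕ} {V : Finset (Fin n)} {Rs : List (Round M B)} {hi : ℝ}
    (hL : 0 < L) (hS : 2 * L ≤ S) (hW : n ≤ W)
    (hG : G.IsBipartiteWith (U : Set (Fin n)) (V : Set (Fin n)))
    (hRs : Triple S W
      (fun Y => ∃ pos, IsPlacement M L (edgePairs G U) pos ∧ Y = placed M B L (edgePairs G U) pos 0)
      Rs
      (fun Y => ∃ F : Finset ℕ,
        (∃ pos, IsPlacement M L ((edgePairs G U).filter fun e => e.2 ∈ F) pos ∧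
          Y = placed M B L ((edgePairs G U).filter fun e => e.2 ∈ F) pos 0) ∧
        ∀ u ∈ U, 1 ≤ (nbrs ((edgePairs G U).filter fun e => e.2 ∈ F) u).card ∧
          ((nbrs ((edgePairs G U).filter fun e => e.2 ∈ F) u).card : ℝ) ≤ hi))
    (hE : IsEdgeDistribution G U M L E) :
    (program S W L Rs).RespectsLimits (fun i => edgeWords (E i)) ∧
      ∃ Vsub : Finset (Fin n), Vsub ⊆ V ∧
        (∀ w : ℕ, (∃ i, w ∈ (program S W L Rs).final (fun i => edgeWords (E i)) i) ↔
          ∃ v ∈ Vsub, (v : ℕ) = w) ∧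
        ∀ u ∈ U, 1 ≤ (G.neighborFinset u ∩ Vsub).card ∧
          ((G.neighborFinset u ∩ Vsub).card : ℝ) ≤ hi := by
  obtain ⟨hv, F, ⟨pos, hpos, hrun⟩, hdeg⟩ := hRs _ (load_eq_placed (B := B) hE)
  set X := (edgePairs G U).filter fun e => e.2 ∈ F with hX
  have hout : ∀ i : Fin M, output (run Rs (fun i => load L i (edgeWords (E i))) i) =
      ((tokensAt L X pos i).image fun x => x.2.2).toList := fun i => by rw [hrun]; rfl
  have hmem : ∀ w : ℕ, (∃ i : Fin M, w ∈ output (run Rs (fun i => load L i (edgeWords (E i))) i)) ↔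
      ∃ e ∈ X, e.2 = w := by
    intro w
    simp only [hout, mem_toList, mem_image, mem_tokensAt]
    constructor
    · rintro ⟨i, x, ⟨h, -, -⟩, rfl⟩
      exact ⟨x.2, h, rfl⟩
    · rintro ⟨e, he, rfl⟩
      exact ⟨⟨pos e / L, div_lt_of_placement hpos he⟩, (pos e, e), ⟨he, rfl, rfl⟩, rfl⟩
  have hXlt : ∀ e ∈ X, e.2 < n := fun e he => by
    obtain ⟨u, v, rfl, -⟩ := exists_of_mem_edgePairs (mem_filter.1 he).1
    exact v.2
  -- Sampled nodes without a surviving edge are left out of the output. This changes no intersection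
  -- with a neighbourhood of a node of `U`.
  refine ⟨respectsLimits_program (fun i => ?_) (fun i w hw => (lt_of_mem_edgeWords hw).trans_le hW)
    hv (fun i => ?_) (fun i w hw => ?_), V.filter fun v => ∃ e ∈ X, e.2 = v, filter_subset _ _,
    fun w => ?_, fun u hu => ?_⟩
  · rw [length_edgeWords]
    have := hE.load i
    omega
  · rw [hout, length_toList]
    have h₁ : (tokensAt L X pos i).card ≤ L :=
      card_image_le.trans (card_filter_div_le hL hpos.inj i)
    have h₂ := card_image_le (s := tokensAt L X pos i) (f := fun x => x.2.2)
    omega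
  · obtain ⟨e, he, rfl⟩ := (hmem w).1 ⟨i, hw⟩
    exact (hXlt e he).trans_le hW
  · rw [final_program, hmem]
    constructor
    · rintro ⟨e, he, rfl⟩
      obtain ⟨u, v, rfl, hu, huv⟩ := exists_of_mem_edgePairs (mem_filter.1 he).1
      have hvV : v ∈ V := by simpa using hG.mem_of_mem_adj (by simpa using hu) huv
      exact ⟨v, mem_filter.2 ⟨hvV, _, he, rfl⟩, rfl⟩
    · rintro ⟨v, hv, rfl⟩
      exact (mem_filter.1 hv).2
  · have hcard : (G.neighborFinset u ∩ V.filter fun v => ∃ e ∈ X, e.2 = (v : ℕ)).card =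
        (nbrs X u).card := by
      rw [← card_map Fin.valEmbedding]
      congr 1
      ext w
      simp only [nbrs, mem_map, mem_inter, mem_filter, mem_image, SimpleGraph.mem_neighborFinset,
        Fin.valEmbedding_apply]
      constructor
      · rintro ⟨v, ⟨huv, -, e, he, hev⟩, rfl⟩
        refine ⟨(u, v), ⟨mem_filter.2 ⟨mem_edgePairs.2 ⟨hu, huv⟩, ?_⟩, rfl⟩, rfl⟩
        exact hev ▸ (mem_filter.1 he).2
      · rintro ⟨e, ⟨he, h₁⟩, rfl⟩
        obtain ⟨u', v, rfl, -, huv⟩ := exists_of_mem_edgePairs (mem_filter.1 he).1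
        obtain rfl : u' = u := Fin.ext h₁
        have hvV : v ∈ V := by simpa using hG.mem_of_mem_adj (by simpa using hu) huv
        exact ⟨v, ⟨huv, hvV, _, he, rfl⟩, rfl⟩
    rw [hcard]
    exact hdeg u hu

end input

theorem length_flatMap_const {β : Type*} {k c : ℕ} {f : ℕ → List β} (h : ∀ j, (f j).length = c) :
    ((List.range k).flatMap f).length = k * c := by
  induction k with
  | zero => simp
  | succ k ih =>
    rw [List.range_succ, List.flatMap_append, List.length_append, ih]
    simp [h, add_mul]

theorem length_sparsify [NeZero B] (r b h k L : ℕ) (p lam : ℝ) (F : ℕ → Finset ℕ) :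
    (sparsify (M := M) (B := B) r b h k L p lam F).length =
      r * (k * (1 + (h + 1)) + (k * (1 + (h + 1)) + 1)) := by
  have hs : (scan (M := M) (B := B) b h).length = h := by
    rw [scan, length_flatMap_const (c := 1) fun _ => rfl, mul_one]
  refine length_flatMap_const fun _ => ?_
  rw [stage, List.length_append, List.length_append, sort, select,
    length_flatMap_const (c := 1 + (h + 1)) fun _ => by simp [hs]; ring,
    length_flatMap_const (c := 1 + (h + 1)) fun _ => by simp [hs]; ring]
  rfl

/-! ### The parameters of the algorithm -/

/-- The number of digits, of levels of the prefix sums, and of stages. -/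
noncomputable def depth (α : ℝ) : ℕ := ⌈10 / α⌉₊

/-- The number of edges that a machine can hold. -/
noncomputable def slots (α : ℝ) (n : ℕ) : ℕ := ⌈(n : ℝ) ^ α⌉₊

/-- The base of the digits of identifiers of nodes and of indices of sets. -/
noncomputable def base (α : ℝ) (n : ℕ) : ℕ := ⌊(n : ℝ) ^ (α / 2)⌋₊ + 1

instance (α : ℝ) (n : ℕ) : NeZero (base α n) := ⟨Nat.succ_ne_zero _⟩

/-- The base of the digits of the numbers of machines. -/
noncomputable def fan (α : ℝ) (n m : ℕ) : ℕ :=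
  ⌈(((n : ℝ) + m) / slots α n) ^ (1 / (depth α : ℝ))⌉₊

/-- The additive deviation from the expectation that is allowed. -/
noncomputable def deviation (α : ℝ) (n : ℕ) : ℝ := (2 * depth α + 2) * Real.logb 2 n

/-- The sampling probability of one stage. -/
noncomputable def prob (α : ℝ) (n Δ : ℕ) (f : ℝ) : ℝ :=
  (16 * 8 ^ depth α * deviation α n * f / Δ) ^ (1 / (depth α : ℝ))

section params
variable {α : ℝ} {n m : ℕ}

theorem depth_mul_ge (hα : 0 < α) : 10 ≤ depth α * α := by
  have h := Nat.le_ceil (10 / α)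
  rwa [div_le_iff₀ hα] at h

theorem depth_ge (hα : 0 < α) (hα₁ : α < 1) : 10 ≤ depth α := by
  have h := depth_mul_ge hα
  have : (10 : ℝ) ≤ depth α := by
    nlinarith [Nat.cast_nonneg (α := ℝ) (depth α)]
  exact_mod_cast this

/-- Here the constant 10 in `depth` pays off: the root of order `depth α` of any power of `n` up to
the fifth is at most `n ^ (α / 2)`. It is used for the cube (number of machines) and the square
(bound on `Δ`). -/
theorem div_depth_le (hα : 0 < α) (hα₁ : α < 1) {x : ℝ} (hx' : x ≤ 5) :
    x / depth α ≤ α / 2 := by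
  have h := depth_mul_ge hα
  have h' : (0 : ℝ) < depth α := by
    have := depth_ge hα hα₁
    exact_mod_cast (by omega : 0 < depth α)
  rw [div_le_iff₀ h']
  linarith

theorem one_le_cast (hn : 2 ≤ n) : (1 : ℝ) ≤ n := by exact_mod_cast (by omega : 1 ≤ n)

theorem one_le_rpow_alpha (hα : 0 < α) (hn : 2 ≤ n) : 1 ≤ (n : ℝ) ^ α :=
  Real.one_le_rpow (one_le_cast hn) hα.le

theorem slots_pos (hα : 0 < α) (hn : 2 ≤ n) : 0 < slots α n :=
  Nat.ceil_pos.2 (lt_of_lt_of_le one_pos (one_le_rpow_alpha hα hn))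

theorem slots_le_two_mul (hα : 0 < α) (hn : 2 ≤ n) : (slots α n : ℝ) ≤ 2 * (n : ℝ) ^ α := by
  have h₁ := one_le_rpow_alpha hα hn
  have h₂ := (Nat.ceil_lt_add_one (zero_le_one.trans h₁)).le
  rw [slots]
  linarith

theorem slots_le (hα₁ : α < 1) (hn : 2 ≤ n) : slots α n ≤ n := by
  rw [slots, Nat.ceil_le]
  calc (n : ℝ) ^ α ≤ (n : ℝ) ^ (1 : ℝ) :=
        Real.rpow_le_rpow_of_exponent_le (one_le_cast hn) hα₁.le
    _ = n := Real.rpow_one _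

theorem base_le_two_mul (hα : 0 < α) (hn : 2 ≤ n) :
    (base α n : ℝ) ≤ 2 * (n : ℝ) ^ (α / 2) := by
  have h₁ := one_le_rpow_alpha (half_pos hα) hn
  have h₂ := Nat.floor_le (zero_le_one.trans h₁)
  rw [base]
  push_cast
  linarith

theorem base_le_slots (hα : 0 < α) (hn : 2 ≤ n) : base α n ≤ slots α n + 1 := by
  rw [base, slots]
  refine Nat.add_le_add_right ((Nat.floor_le_ceil _).trans (Nat.ceil_mono ?_)) 1
  exact Real.rpow_le_rpow_of_exponent_le (one_le_cast hn) (by linarith)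

theorem base_le (hα : 0 < α) (hα₁ : α < 1) (hn : 2 ≤ n) : base α n ≤ n ^ 2 := by
  have h₁ := base_le_slots hα hn
  have h₂ := slots_le hα₁ hn
  nlinarith

theorem base_pow_le (hα : 0 < α) (hα₁ : α < 1) (hn : 2 ≤ n) :
    base α n ^ depth α ≤ n ^ (2 * depth α) := by
  rw [pow_mul]
  exact Nat.pow_le_pow_left (base_le hα hα₁ hn) _

/-- One exponent serves two purposes: the digits cover all node identifiers, and there are more
candidate sets than the total cost `n ^ 2 * n`. -/
theorem lt_base_pow (hα : 0 < α) (hα₁ : α < 1) (hn : 2 ≤ n) : n ^ 3 < base α n ^ depth α := by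
  have h₁ : (n : ℝ) ^ (α / 2) < base α n := by
    rw [base]
    push_cast
    exact Nat.lt_floor_add_one _
  have h₂ : ((n : ℝ) ^ (α / 2)) ^ depth α < (base α n : ℝ) ^ depth α :=
    pow_lt_pow_left₀ h₁ (by positivity) (by have := depth_ge hα hα₁; omega)
  have h₃ : (n : ℝ) ^ 3 ≤ ((n : ℝ) ^ (α / 2)) ^ depth α := by
    rw [← Real.rpow_natCast, ← Real.rpow_natCast, ← Real.rpow_mul (by positivity)]
    refine Real.rpow_le_rpow_of_exponent_le (one_le_cast hn) ?_
    have := depth_mul_ge hα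
    push_cast
    linarith
  exact_mod_cast h₃.trans_lt h₂

theorem fan_pos (hα : 0 < α) (hn : 2 ≤ n) : 0 < fan α n m := by
  have h₁ := one_le_cast hn
  have h₂ : (0 : ℝ) < slots α n := by exact_mod_cast slots_pos hα hn
  exact Nat.ceil_pos.2 (Real.rpow_pos_of_pos (by positivity) _)

theorem le_fan_pow (hα : 0 < α) (hα₁ : α < 1) (hn : 2 ≤ n) :
    n + m ≤ fan α n m ^ depth α * slots α n := by
  have h₂ : (0 : ℝ) < slots α n := by exact_mod_cast slots_pos hα hn
  have hd : depth α ≠ 0 := by have := depth_ge hα hα₁; omega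
  have h₃ : ((n : ℝ) + m) / slots α n ≤ (fan α n m : ℝ) ^ depth α := by
    calc ((n : ℝ) + m) / slots α n =
        ((((n : ℝ) + m) / slots α n) ^ (1 / (depth α : ℝ))) ^ depth α := by
          rw [one_div, Real.rpow_inv_natCast_pow (by positivity) hd]
      _ ≤ _ := pow_le_pow_left₀ (by positivity) (Nat.le_ceil _) _
  rw [div_le_iff₀ h₂] at h₃
  exact_mod_cast h₃

/-- The root being rounded up is at least 1, so rounding costs a factor of at most 2 per level. This
keeps the global space linear although the number of machines must be a perfect power. -/
theorem fan_pow_le (hα : 0 < α) (hα₁ : α < 1) (hn : 2 ≤ n) :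
    fan α n m ^ depth α * slots α n ≤ 2 ^ depth α * (n + m) := by
  have h₁ : (0 : ℝ) < slots α n := by exact_mod_cast slots_pos hα hn
  have h₂ : (slots α n : ℝ) ≤ n + m := by
    have : slots α n ≤ n + m := (slots_le hα₁ hn).trans (Nat.le_add_right _ _)
    exact_mod_cast this
  have hd : depth α ≠ 0 := by have := depth_ge hα hα₁; omega
  have h₃ : 1 ≤ ((n : ℝ) + m) / slots α n := (one_le_div h₁).2 h₂
  have h₄ : 1 ≤ (((n : ℝ) + m) / slots α n) ^ (1 / (depth α : ℝ)) :=
    Real.one_le_rpow h₃ (by positivity)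
  have h₅ : (fan α n m : ℝ) ≤ 2 * (((n : ℝ) + m) / slots α n) ^ (1 / (depth α : ℝ)) := by
    have := (Nat.ceil_lt_add_one (zero_le_one.trans h₄)).le
    rw [fan]
    linarith
  have h₆ : (fan α n m : ℝ) ^ depth α ≤ 2 ^ depth α * (((n : ℝ) + m) / slots α n) := by
    calc (fan α n m : ℝ) ^ depth α
        ≤ (2 * (((n : ℝ) + m) / slots α n) ^ (1 / (depth α : ℝ))) ^ depth α :=
          pow_le_pow_left₀ (by positivity) h₅ _
      _ = _ := by rw [mul_pow, one_div, Real.rpow_inv_natCast_pow (by positivity) hd]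
  have h₇ := mul_le_mul_of_nonneg_right h₆ h₁.le
  rw [mul_assoc, div_mul_cancel₀ _ h₁.ne'] at h₇
  exact_mod_cast h₇

/-- Both factors are at most `2 * n ^ (α / 2)`; their product is the traffic of one machine in a
round of the prefix sums. -/
theorem fan_mul_base_le (hα : 0 < α) (hα₁ : α < 1) (hn : 2 ≤ n) (hm : m ≤ n ^ 2) :
    fan α n m * base α n ≤ 16 * slots α n := by
  have hn1 := one_le_cast hn
  have h₁ : (1 : ℝ) ≤ slots α n := by exact_mod_cast slots_pos hα hn
  have hnm : (n : ℝ) + m ≤ (n : ℝ) ^ (3 : ℝ) := by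
    have h : n + m ≤ n ^ 3 := by nlinarith
    have h' : ((n + m : ℕ) : ℝ) ≤ ((n ^ 3 : ℕ) : ℝ) := by exact_mod_cast h
    push_cast at h'
    rw [show (3 : ℝ) = ((3 : ℕ) : ℝ) by norm_num, Real.rpow_natCast]
    exact h'
  have h₂ : (((n : ℝ) + m) / slots α n) ^ (1 / (depth α : ℝ)) ≤ (n : ℝ) ^ (α / 2) := by
    calc (((n : ℝ) + m) / slots α n) ^ (1 / (depth α : ℝ))
        ≤ ((n : ℝ) ^ (3 : ℝ)) ^ (1 / (depth α : ℝ)) :=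
          Real.rpow_le_rpow (by positivity) ((div_le_self (by positivity) h₁).trans hnm)
            (by positivity)
      _ = (n : ℝ) ^ (3 / (depth α : ℝ)) := by
          rw [← Real.rpow_mul (by positivity), mul_one_div]
      _ ≤ _ := Real.rpow_le_rpow_of_exponent_le hn1 (div_depth_le hα hα₁ (by norm_num))
  have h₃ : (fan α n m : ℝ) ≤ 2 * (n : ℝ) ^ (α / 2) := by
    have h₄ := (Nat.ceil_lt_add_one (a := (((n : ℝ) + m) / slots α n) ^ (1 / (depth α : ℝ)))
      (by positivity)).le
    have h₅ := one_le_rpow_alpha (half_pos hα) hn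
    rw [fan]
    linarith
  have h₄ : (fan α n m : ℝ) * base α n ≤ 4 * (n : ℝ) ^ α := by
    calc (fan α n m : ℝ) * base α n ≤ (2 * (n : ℝ) ^ (α / 2)) * (2 * (n : ℝ) ^ (α / 2)) :=
          mul_le_mul h₃ (base_le_two_mul hα hn) (by positivity) (by positivity)
      _ = 4 * ((n : ℝ) ^ (α / 2) * (n : ℝ) ^ (α / 2)) := by ring
      _ = 4 * (n : ℝ) ^ α := by rw [← Real.rpow_add (by linarith), add_halves]
  have h₅ : (n : ℝ) ^ α ≤ slots α n := Nat.le_ceil _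
  have h₆ : (fan α n m : ℝ) * base α n ≤ 16 * slots α n := by linarith
  exact_mod_cast h₆

theorem one_le_logb (hn : 2 ≤ n) : 1 ≤ Real.logb 2 n := by
  rw [Real.le_logb_iff_rpow_le (by norm_num) (by positivity), Real.rpow_one]
  exact_mod_cast hn

theorem one_le_deviation (hn : 2 ≤ n) : 1 ≤ deviation α n := by
  rw [deviation]
  nlinarith [one_le_logb hn, Nat.cast_nonneg (α := ℝ) (depth α)]

theorem two_rpow_neg_deviation (hn : 2 ≤ n) :
    (2 : ℝ) ^ (-deviation α n) = ((n : ℝ) ^ (2 * depth α + 2))⁻¹ := by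
  rw [Real.rpow_neg (by norm_num), deviation, mul_comm, Real.rpow_mul (by norm_num),
    Real.rpow_logb (by norm_num) (by norm_num) (by positivity), ← Real.rpow_natCast]
  push_cast
  rfl

/-- `deviation` is chosen so that the failure probability `n ^ (-(2 * depth α + 2))` beats the at
most `n ^ (2 * depth α)` candidates. -/
theorem union_bound (hα : 0 < α) (hα₁ : α < 1) (hn : 2 ≤ n) :
    2 * (2 : ℝ) ^ (-deviation α n) * (n * (base α n ^ depth α : ℕ)) ≤ 1 := by
  have h₁ : (0 : ℝ) < (n : ℝ) ^ (2 * depth α + 2) := by positivity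
  rw [two_rpow_neg_deviation hn, mul_comm, ← mul_assoc, ← div_eq_mul_inv, div_le_one h₁]
  have h₂ : n * base α n ^ depth α * 2 ≤ n ^ (2 * depth α + 2) := by
    calc n * base α n ^ depth α * 2 ≤ n * n ^ (2 * depth α) * n :=
          Nat.mul_le_mul (Nat.mul_le_mul_left _ (base_pow_le hα hα₁ hn)) hn
      _ = n ^ (2 * depth α + 2) := by ring
  exact_mod_cast h₂

end params

/-! ### The algorithm and its correctness -/

open Classical in
/-- A family of subsets of `range n` that sample well. -/
noncomputable def family (α : ℝ) (n Δ : ℕ) (f : ℝ) : ℕ → Finset ℕ :=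
  Classical.epsilon fun F => ∀ N ⊆ range n, ((range (base α n ^ depth α)).filter fun t =>
    Bad (prob α n Δ f) (deviation α n) N (F t)).card ≤ n

/-- The condition under which it is necessary and possible to sparsify. -/
def Dense (α : ℝ) (n Δ : ℕ) (f : ℝ) : Prop :=
  3 ≤ n ∧ 16 * 8 ^ depth α * deviation α n * f ≤ Δ ∧ 4 * deviation α n ≤ prob α n Δ f * slots α n

open Classical in
/-- The rounds of the algorithm. -/
noncomputable def sparsifyRounds (α : ℝ) (n m Δ : ℕ) (f : ℝ) :
    List (Round (fan α n m ^ depth α) (base α n)) :=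
  if Dense α n Δ f then
    sparsify (depth α) (fan α n m) (depth α) (depth α) (slots α n) (prob α n Δ f)
      (deviation α n) (family α n Δ f)
  else []

/-- The algorithm. -/
noncomputable def algorithm (α : ℝ) (n m Δ : ℕ) (f : ℝ) : MPCProgram :=
  program (16 * slots α n) (n ^ (4 * depth α + 12)) (slots α n) (sparsifyRounds α n m Δ f)

section correctness
variable {α : ℝ} {n m Δ : ℕ} {f : ℝ}

theorem length_sparsifyRounds_le : (sparsifyRounds α n m Δ f).length ≤
    depth α * (depth α * (1 + (depth α + 1)) + (depth α * (1 + (depth α + 1)) + 1)) := by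
  rw [sparsifyRounds]
  split_ifs
  · rw [length_sparsify]
  · exact Nat.zero_le _

open Classical in
theorem family_spec (hα : 0 < α) (hα₁ : α < 1) (hn : 3 ≤ n) (hp₀ : 0 ≤ prob α n Δ f)
    (hp₁ : prob α n Δ f ≤ 1) :
    ∀ N ⊆ range n, ((range (base α n ^ depth α)).filter fun t =>
      Bad (prob α n Δ f) (deviation α n) N (family α n Δ f t)).card ≤ n := by
  obtain ⟨F, hF⟩ := exists_sampling_family hn hp₀ hp₁ (union_bound hα hα₁ (by omega : 2 ≤ n))
  exact Classical.epsilon_spec (p := fun F : ℕ → Finset ℕ => ∀ N ⊆ range n,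
    ((range (base α n ^ depth α)).filter fun t =>
      Bad (prob α n Δ f) (deviation α n) N (F t)).card ≤ n) ⟨F, fun N hN => (hF N hN).le⟩

variable {G : SimpleGraph (Fin n)} [DecidableRel G.Adj] {U : Finset (Fin n)}

theorem edgePairs_lt {e : ℕ × ℕ} (he : e ∈ edgePairs G U) : e.1 < n ∧ e.2 < n := by
  obtain ⟨u, v, rfl, -⟩ := exists_of_mem_edgePairs he
  exact ⟨u.2, v.2⟩

theorem card_edgePairs_le : (edgePairs G U).card ≤ n ^ 2 := by
  calc (edgePairs G U).card ≤ (range n ×ˢ range n).card := card_le_card fun e he => by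
        simpa using edgePairs_lt he
    _ = n ^ 2 := by rw [card_product, card_range, sq]

theorem code_lt_of_mem_edgePairs (hα : 0 < α) (hα₁ : α < 1) (hn : 2 ≤ n) (hm : m ≤ n ^ 2) :
    ∀ a < fan α n m ^ depth α * slots α n, ∀ e ∈ edgePairs G U,
      code (a, e) < n ^ (4 * depth α + 12) := by
  intro a ha e he
  have h₁ : n ≤ n ^ (depth α + 3) := Nat.le_self_pow (by omega) n
  have h₂ : fan α n m ^ depth α * slots α n ≤ n ^ (depth α + 3) := by
    calc _ ≤ 2 ^ depth α * (n + m) := fan_pow_le hα hα₁ hn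
      _ ≤ n ^ depth α * n ^ 3 :=
        Nat.mul_le_mul (Nat.pow_le_pow_left hn _) (by nlinarith)
      _ = n ^ (depth α + 3) := (pow_add _ _ _).symm
  have h₃ : n ^ (depth α + 3) ≤ (n ^ (depth α + 3)) ^ 2 := Nat.le_self_pow (by omega) _
  have h₄ := edgePairs_lt he
  have h₅ := code_lt (Q := n ^ (depth α + 3)) (x := (a, e)) (by simp only; omega)
    (by simp only; omega) (by simp only; omega)
  calc code (a, e) < _ := h₅
    _ = n ^ (4 * depth α + 12) := by ring

theorem memory_bound (hα : 0 < α) (hn : 2 ≤ n) :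
    1 + 2 * base α n + slots α n ≤ 16 * slots α n := by
  have h₁ := slots_pos hα hn
  have h₂ := base_le_slots hα hn
  omega

theorem sparsifyRounds_triple_dense (hα : 0 < α) (hα₁ : α < 1) (hm : m ≤ n ^ 2) (hf : 0 < f)
    (hd : Dense α n Δ f) (hU : ∀ u ∈ U, (Δ : ℝ) / f ≤ G.degree u ∧ G.degree u ≤ Δ) :
    Triple (16 * slots α n) (n ^ (4 * depth α + 12))
      (fun Y => ∃ pos, IsPlacement (fan α n m ^ depth α) (slots α n) (edgePairs G U) pos ∧
        Y = placed _ (base α n) (slots α n) (edgePairs G U) pos 0)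
      (sparsifyRounds α n m Δ f)
      (fun Y => ∃ F : Finset ℕ, (∃ pos, IsPlacement (fan α n m ^ depth α) (slots α n)
          ((edgePairs G U).filter fun e => e.2 ∈ F) pos ∧
          Y = placed _ (base α n) (slots α n) ((edgePairs G U).filter fun e => e.2 ∈ F) pos 0) ∧
        ∀ u ∈ U, 1 ≤ (nbrs ((edgePairs G U).filter fun e => e.2 ∈ F) u).card ∧
          ((nbrs ((edgePairs G U).filter fun e => e.2 ∈ F) u).card : ℝ) ≤
            16 * 32 ^ depth α * deviation α n * f) := by
  obtain ⟨hn3, hd₁, hd₂⟩ := id hd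
  have hn : 2 ≤ n := by omega
  have hdev := one_le_deviation (α := α) hn
  have hdp := depth_ge hα hα₁
  have hΔ : (0 : ℝ) < Δ := lt_of_lt_of_le (by positivity) hd₁
  have hx₀ : 0 ≤ 16 * 8 ^ depth α * deviation α n * f / Δ := by positivity
  have hp₀ : 0 ≤ prob α n Δ f := Real.rpow_nonneg hx₀ _
  have hp₁ : prob α n Δ f ≤ 1 :=
    Real.rpow_le_one hx₀ ((div_le_one hΔ).2 hd₁) (by positivity)
  have hpd : prob α n Δ f ^ depth α = 16 * 8 ^ depth α * deviation α n * f / Δ := by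
    rw [prob, one_div, Real.rpow_inv_natCast_pow hx₀ (by omega)]
  -- `prob` is normalized so that the lower bound after the last stage is exactly the `16 * lam`
  -- required by `sparsify_triple`; the upper bound then carries `4 * 8 = 32` per stage.
  have hlo : (Δ : ℝ) / f * (prob α n Δ f / 8) ^ depth α = 16 * deviation α n := by
    rw [div_pow, hpd]
    field_simp
  have hhi : (Δ : ℝ) * (4 * prob α n Δ f) ^ depth α = 16 * 32 ^ depth α * deviation α n * f := by
    rw [mul_pow, hpd, show (32 : ℝ) = 4 * 8 by norm_num, mul_pow]
    field_simp
  have hB := lt_base_pow hα hα₁ hn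
  have hn_le : n ≤ n ^ 3 := Nat.le_self_pow (by omega) n
  have hcard := card_edgePairs_le (G := G) (U := U)
  have hW : n ^ 2 < n ^ (4 * depth α + 12) := Nat.pow_lt_pow_right (by omega) (by omega)
  have key := sparsify_triple (r := depth α) (S := 16 * slots α n)
    (W := n ^ (4 * depth α + 12)) (X := edgePairs G U) (U := U.map Fin.valEmbedding)
    (h := depth α) rfl (fan_pos (m := m) hα hn) (slots_pos hα hn) (memory_bound hα hn)
    (fan_mul_base_le hα hα₁ hn hm) (by omega : 0 < depth α)
    (fun e he => by have := (edgePairs_lt he).1; omega) (fun e he => (edgePairs_lt he).2)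
    (by nlinarith) (by omega)
    ((base_pow_le hα hα₁ hn).trans (Nat.pow_le_pow_right (by omega) (by omega)))
    (code_lt_of_mem_edgePairs hα hα₁ hn hm) hp₀ hp₁ (by linarith) hd₂
    (family_spec hα hα₁ hn3 hp₀ hp₁) (lo := (Δ : ℝ) / f) (hi := Δ) (by positivity) hlo.ge ?_
  · rw [sparsifyRounds, if_pos hd]
    refine key.mono (fun _ hY => hY) ?_
    rintro Y ⟨F, hY, hF⟩
    refine ⟨F, hY, fun u hu => ?_⟩
    obtain ⟨h₁, h₂⟩ := hF u (mem_map_of_mem Fin.valEmbedding hu)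
    rw [hlo] at h₁
    rw [hhi] at h₂
    refine ⟨?_, h₂⟩
    have h₃ : (1 : ℝ) ≤ (nbrs ((edgePairs G U).filter fun e => e.2 ∈ F) u).card :=
      le_trans (by linarith) h₁
    exact_mod_cast h₃
  · intro u hu
    obtain ⟨v, hv, rfl⟩ := mem_map.1 hu
    rw [Fin.valEmbedding_apply, card_nbrs_edgePairs hv]
    exact ⟨(hU v hv).1, by exact_mod_cast (hU v hv).2⟩

theorem sparsifyRounds_triple_sparse (hα : 0 < α) (hα₁ : α < 1) (hn : 2 ≤ n) (hm : m ≤ n ^ 2)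
    (hd : ¬ Dense α n Δ f) {hi : ℝ}
    (hU : ∀ u ∈ U, 1 ≤ G.degree u ∧ (G.degree u : ℝ) ≤ hi) :
    Triple (16 * slots α n) (n ^ (4 * depth α + 12))
      (fun Y => ∃ pos, IsPlacement (fan α n m ^ depth α) (slots α n) (edgePairs G U) pos ∧
        Y = placed _ (base α n) (slots α n) (edgePairs G U) pos 0)
      (sparsifyRounds α n m Δ f)
      (fun Y => ∃ F : Finset ℕ, (∃ pos, IsPlacement (fan α n m ^ depth α) (slots α n)
          ((edgePairs G U).filter fun e => e.2 ∈ F) pos ∧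
          Y = placed _ (base α n) (slots α n) ((edgePairs G U).filter fun e => e.2 ∈ F) pos 0) ∧
        ∀ u ∈ U, 1 ≤ (nbrs ((edgePairs G U).filter fun e => e.2 ∈ F) u).card ∧
          ((nbrs ((edgePairs G U).filter fun e => e.2 ∈ F) u).card : ℝ) ≤ hi) := by
  rw [sparsifyRounds, if_neg hd]
  rintro Y ⟨pos, hpos, rfl⟩
  refine ⟨hpos.fits (slots_pos hα hn) (code_lt_of_mem_edgePairs hα hα₁ hn hm)
    (Nat.pow_pos (by omega)) (memory_bound hα hn), range n, ?_⟩
  have hf : ((edgePairs G U).filter fun e => e.2 ∈ range n) = edgePairs G U :=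
    filter_true_of_mem fun e he => mem_range.2 (edgePairs_lt he).2
  rw [hf]
  refine ⟨⟨pos, hpos, rfl⟩, fun u hu => ?_⟩
  rw [card_nbrs_edgePairs hu]
  exact hU u hu

/-! ### The bounds on the parameters -/

theorem one_le_of_le {c : ℝ} (hc : 0 < c) (hn : 2 ≤ n) (hf : Real.logb 2 n ^ c ≤ f) : 1 ≤ f :=
  (Real.one_le_rpow (one_le_logb hn) hc.le).trans hf

theorem two_rpow_mul_logb {C : ℝ} (hf : 0 < f) : (2 : ℝ) ^ (C * Real.logb 2 f) = f ^ C := by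
  rw [mul_comm, Real.rpow_mul (by norm_num), Real.rpow_logb (by norm_num) (by norm_num) hf]

/-- From `Δ ≤ n * f` and `f ≤ Δ ^ 0.4` follows `Δ ^ 0.6 ≤ n`. The exponent 2 is a convenient
weakening of 5/3. -/
theorem le_sq_of_degree {d : ℕ} (hn : 2 ≤ n) (hf₁ : 1 ≤ f)
    (hf : f ≤ (Δ : ℝ) ^ (0.4 : ℝ) / Real.logb 2 n) (h : (Δ : ℝ) / f ≤ d) (hd : d ≤ n) :
    (Δ : ℝ) ≤ (n : ℝ) ^ (2 : ℝ) := by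
  have hn1 := one_le_cast hn
  have h₁ : f ≤ (Δ : ℝ) ^ (0.4 : ℝ) := hf.trans (div_le_self (by positivity) (one_le_logb hn))
  have hd' : (d : ℝ) ≤ n := by exact_mod_cast hd
  rcases Nat.eq_zero_or_pos Δ with rfl | hΔ
  · simp only [Nat.cast_zero]
    positivity
  have hΔ' : (0 : ℝ) < Δ := by exact_mod_cast hΔ
  have h₂ : (Δ : ℝ) ≤ n * (Δ : ℝ) ^ (0.4 : ℝ) := by
    rw [div_le_iff₀ (by linarith)] at h
    exact h.trans (mul_le_mul hd' h₁ (by linarith) (by linarith))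
  have h₃ : (Δ : ℝ) = (Δ : ℝ) ^ (0.6 : ℝ) * (Δ : ℝ) ^ (0.4 : ℝ) := by
    rw [← Real.rpow_add hΔ']
    norm_num
  have h₄ : (Δ : ℝ) ^ (0.6 : ℝ) ≤ n := by
    rw [h₃] at h₂
    refine le_of_mul_le_mul_right ?_ (Real.rpow_pos_of_pos hΔ' (0.4 : ℝ))
    rwa [← h₃] at h₂ ⊢
  by_contra! hc
  have h₅ : ((n : ℝ) ^ (2 : ℝ)) ^ (0.6 : ℝ) < (Δ : ℝ) ^ (0.6 : ℝ) :=
    Real.rpow_lt_rpow (by positivity) hc (by norm_num)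
  rw [← Real.rpow_mul (by positivity)] at h₅
  have h₆ : (n : ℝ) ^ (1 : ℝ) ≤ (n : ℝ) ^ ((2 : ℝ) * 0.6) :=
    Real.rpow_le_rpow_of_exponent_le hn1 (by norm_num)
  rw [Real.rpow_one] at h₆
  linarith

theorem exists_threshold (hα : 0 < α) : ∃ n₀ : ℕ, ∀ n ≥ n₀,
    4 * deviation α n ≤ (n : ℝ) ^ (α / 2) := by
  have h := (isLittleO_log_rpow_atTop (half_pos hα)).comp_tendsto tendsto_natCast_atTop_atTop
  have hK : (0 : ℝ) < Real.log 2 / (4 * (2 * depth α + 2)) := by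
    have := Real.log_pos (by norm_num : (1 : ℝ) < 2)
    positivity
  have h' := h.bound hK
  obtain ⟨n₀, hn₀⟩ := Filter.eventually_atTop.1 h'
  refine ⟨n₀, fun n hn => ?_⟩
  have h₁ := hn₀ n hn
  simp only [Function.comp_apply, Real.norm_eq_abs] at h₁
  rw [abs_of_nonneg (a := (n : ℝ) ^ (α / 2)) (by positivity)] at h₁
  have h₂ := (le_abs_self _).trans h₁
  have hl := Real.log_pos (by norm_num : (1 : ℝ) < 2)
  rw [deviation, Real.logb]
  rw [div_mul_eq_mul_div, le_div_iff₀ (by positivity)] at h₂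
  rw [← mul_assoc, mul_div_assoc', div_le_iff₀ hl]
  linarith

/-- As `Δ ≤ n ^ 2`, the probability is at least `n ^ (-(α / 2))`. Together with `exists_threshold`
this gives the last condition of `Dense` for large `n`. -/
theorem le_prob_mul_slots (hα : 0 < α) (hα₁ : α < 1) (hn : 2 ≤ n) (hf : 1 ≤ f) (hΔ : 0 < Δ)
    (hΔn : (Δ : ℝ) ≤ (n : ℝ) ^ (2 : ℝ)) : (n : ℝ) ^ (α / 2) ≤ prob α n Δ f * slots α n := by
  have hn1 := one_le_cast hn
  have hdev := one_le_deviation (α := α) hn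
  have hΔ' : (0 : ℝ) < Δ := by exact_mod_cast hΔ
  have h₁ : (n : ℝ) ^ α ≤ slots α n := Nat.le_ceil _
  have h₂ : (n : ℝ) ^ (-(α / 2)) ≤ prob α n Δ f := by
    calc (n : ℝ) ^ (-(α / 2)) ≤ (n : ℝ) ^ (-(2 / (depth α : ℝ))) :=
          Real.rpow_le_rpow_of_exponent_le hn1
            (neg_le_neg (div_depth_le hα hα₁ (by norm_num)))
      _ = ((n : ℝ) ^ (-2 : ℝ)) ^ (1 / (depth α : ℝ)) := by
          rw [← Real.rpow_mul (by positivity)]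
          congr 1
          ring
      _ ≤ prob α n Δ f := by
          refine Real.rpow_le_rpow (by positivity) ?_ (by positivity)
          rw [Real.rpow_neg (by positivity), ← one_div]
          have h₃ : (1 : ℝ) ≤ 16 * 8 ^ depth α * deviation α n * f := by
            have h₄ : (1 : ℝ) ≤ 8 ^ depth α := one_le_pow₀ (by norm_num)
            exact one_le_mul_of_one_le_of_one_le (one_le_mul_of_one_le_of_one_le
              (one_le_mul_of_one_le_of_one_le (by norm_num) h₄) hdev) hf
          exact div_le_div₀ (by linarith) h₃ hΔ' hΔn
  calc (n : ℝ) ^ (α / 2) = (n : ℝ) ^ (-(α / 2)) * (n : ℝ) ^ α := by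
        rw [← Real.rpow_add (by linarith)]
        congr 1
        ring
    _ ≤ _ := mul_le_mul h₂ h₁ (by positivity) ((by positivity : (0 : ℝ) ≤ _).trans h₂)

/-- For `n ≥ 3` the logarithm is at least `logb 2 3 > 1`, so `f` is bounded away from 1 and a power
of it absorbs any constant. For `n = 2` this fails, as `f = 1` is not excluded. -/
theorem exists_exponent {c : ℝ} (hc : 0 < c) (K : ℝ) : ∃ C₁ : ℝ, 0 ≤ C₁ ∧
    ∀ (n : ℕ) (f : ℝ), 3 ≤ n → Real.logb 2 n ^ c ≤ f → K ≤ f ^ C₁ := by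
  have hl : 1 < Real.logb 2 3 := by
    rw [Real.lt_logb_iff_rpow_lt (by norm_num) (by norm_num)]
    norm_num
  have hb : 1 < Real.logb 2 3 ^ c := Real.one_lt_rpow hl hc
  obtain ⟨N, hN⟩ := pow_unbounded_of_one_lt K hb
  refine ⟨N, Nat.cast_nonneg _, fun n f hn hf => ?_⟩
  have h₁ : Real.logb 2 3 ≤ Real.logb 2 n :=
    Real.logb_le_logb_of_le (by norm_num) (by norm_num) (by exact_mod_cast hn)
  have h₂ : Real.logb 2 3 ^ c ≤ f := (Real.rpow_le_rpow (by linarith) h₁ hc.le).trans hf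
  rw [Real.rpow_natCast]
  exact hN.le.trans (pow_le_pow_left₀ (by linarith) h₂ _)

theorem logb_le_rpow {c : ℝ} (hc : 0 < c) (hn : 2 ≤ n) (hf : Real.logb 2 n ^ c ≤ f) :
    Real.logb 2 n ≤ f ^ (1 / c) := by
  have h₀ : 0 ≤ Real.logb 2 n := zero_le_one.trans (one_le_logb hn)
  calc Real.logb 2 n = (Real.logb 2 n ^ c) ^ (1 / c) := by
        rw [← Real.rpow_mul h₀, mul_one_div_cancel hc.ne', Real.rpow_one]
    _ ≤ _ := Real.rpow_le_rpow (by positivity) hf (by positivity)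

end correctness
end MPC

/-! ### The main theorem -/

theorem mainTheorem3 (α : ℝ) (hα₀ : 0 < α) (hα₁ : α < 1) (c : ℝ) (hc : 0 < c) :
    -- one algorithm, which is told the numbers `n` of nodes and `m` of edges, `Δ`, and `f`
    ∃ (A : (n m Δ : ℕ) → (f : ℝ) → MPCProgram) (C : ℝ), 0 < C ∧
      ∀ (n Δ : ℕ) (f : ℝ), 2 ≤ n →
        (Real.logb 2 n) ^ c ≤ f → f ≤ (Δ : ℝ) ^ (0.4 : ℝ) / Real.logb 2 n →
      ∀ (G : SimpleGraph (Fin n)) [DecidableRel G.Adj] (U V : Finset (Fin n)),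
        G.IsBipartiteWith (U : Set (Fin n)) (V : Set (Fin n)) → U ∪ V = Finset.univ →
        (∀ u ∈ U, (Δ : ℝ) / f ≤ (G.degree u : ℝ) ∧ G.degree u ≤ Δ) →
      ∀ (m : ℕ) (P : MPCProgram), m = G.edgeFinset.card → P = A n m Δ f →
        -- local memory, global space, word size, and number of rounds
        (P.memory : ℝ) ≤ C * (n : ℝ) ^ α ∧
        (P.machines : ℝ) * (P.memory : ℝ) ≤ C * ((n : ℝ) + (m : ℝ)) ∧
        (P.wordBound : ℝ) ≤ (n : ℝ) ^ C ∧
        (P.rounds : ℝ) ≤ C * max 1 (Real.logb 2 (Real.logb 2 Δ)) ∧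
        -- there are enough machines for the input
        n + m ≤ P.machines * ⌈(n : ℝ) ^ α⌉₊ ∧
        -- correctness, for every initial distribution of the edges
        ∀ E : Fin P.machines → List (Fin n × Fin n),
          IsEdgeDistribution G U P.machines ⌈(n : ℝ) ^ α⌉₊ E →
          P.RespectsLimits (fun i => edgeWords (E i)) ∧
          ∃ Vsub : Finset (Fin n), Vsub ⊆ V ∧
            (∀ w : ℕ, (∃ i, w ∈ P.final (fun i => edgeWords (E i)) i) ↔
              ∃ v ∈ Vsub, (v : ℕ) = w) ∧
            ∀ u ∈ U, 1 ≤ (G.neighborFinset u ∩ Vsub).card ∧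
              ((G.neighborFinset u ∩ Vsub).card : ℝ) ≤ (2 : ℝ) ^ (C * Real.logb 2 f) := by
  open MPC in
  obtain ⟨n₀, hn₀⟩ := exists_threshold hα₀
  set D : ℕ := depth α with hD
  -- The constants to be absorbed into a power of `f`: the factor in the final degree, and the
  -- threshold below which no sampling is guaranteed.
  set K : ℝ := 16 * 32 ^ D * (2 * D + 2) + n₀ with hK
  obtain ⟨C₁, hC₁, hC₁K⟩ := exists_exponent hc K
  set R : ℕ := D * (D * (1 + (D + 1)) + (D * (1 + (D + 1)) + 1)) + 2 with hR
  have hc' : 0 < 1 / c := by positivity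
  -- One summand group for each requirement: local memory, global space, word size, rounds, and the
  -- exponent of `f` in the degree bound.
  set C : ℝ := 32 + 16 * 2 ^ D + (4 * D + 12) + R + (C₁ + 1 / c + 1) with hC
  have hD0 : (0 : ℝ) ≤ D := Nat.cast_nonneg _
  have hR0 : (0 : ℝ) ≤ R := Nat.cast_nonneg _
  have h2D : (0 : ℝ) < 2 ^ D := by positivity
  have hCpos : 0 < C := by positivity
  refine ⟨algorithm α, C, hCpos, ?_⟩
  rintro n Δ f hn hf₁ hf₂ G _ U V hG - hU m P hm rfl
  have hn1 := one_le_cast hn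
  have hf : 1 ≤ f := one_le_of_le hc hn hf₁
  have hmn : m ≤ n ^ 2 := by
    have h₁ := G.card_edgeFinset_le_card_choose_two
    rw [Fintype.card_fin] at h₁
    have h₂ := Nat.choose_le_pow n 2
    omega
  have hpow : ∀ {x : ℝ}, x ≤ C → f ^ x ≤ f ^ C := fun hx =>
    Real.rpow_le_rpow_of_exponent_le hf hx
  refine ⟨?_, ?_, ?_, ?_, le_fan_pow hα₀ hα₁ hn, ?_⟩
  · have h₁ := slots_le_two_mul hα₀ hn
    have h₂ : 32 * (n : ℝ) ^ α ≤ C * (n : ℝ) ^ α :=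
      mul_le_mul_of_nonneg_right (by linarith) (by positivity)
    simp only [algorithm]
    push_cast
    linarith
  · have h₁ : ((fan α n m ^ depth α * slots α n : ℕ) : ℝ) ≤ (2 ^ depth α * (n + m) : ℕ) := by
      exact_mod_cast fan_pow_le hα₀ hα₁ hn
    have h₂ : 16 * 2 ^ D * ((n : ℝ) + m) ≤ C * ((n : ℝ) + m) :=
      mul_le_mul_of_nonneg_right (by linarith) (by positivity)
    simp only [algorithm]
    push_cast at h₁ ⊢
    linarith
  · simp only [algorithm]
    push_cast
    rw [← Real.rpow_natCast]
    refine Real.rpow_le_rpow_of_exponent_le hn1 ?_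
    push_cast
    linarith
  · have h₁ : (algorithm α n m Δ f).rounds ≤ R := Nat.add_le_add_right length_sparsifyRounds_le 2
    have h₂ : ((algorithm α n m Δ f).rounds : ℝ) ≤ R := by exact_mod_cast h₁
    have h₃ : C * 1 ≤ C * max 1 (Real.logb 2 (Real.logb 2 Δ)) :=
      mul_le_mul_of_nonneg_left (le_max_left _ _) hCpos.le
    linarith
  intro E hE
  refine program_correct (slots_pos hα₀ hn) (by omega) (Nat.le_self_pow (by omega) n) hG ?_ hE
  rw [two_rpow_mul_logb (by linarith)]
  have hlogf := logb_le_rpow hc hn hf₁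
  have hdev : deviation α n ≤ (2 * D + 2) * f ^ (1 / c) :=
    mul_le_mul_of_nonneg_left hlogf (by positivity)
  have hsize : 3 ≤ n → 16 * 32 ^ D * deviation α n * f ≤ f ^ C := by
    intro hn3
    have h₁ : 16 * 32 ^ D * (2 * D + 2) ≤ f ^ C₁ :=
      le_trans (by linarith [Nat.cast_nonneg (α := ℝ) n₀]) (hC₁K n f hn3 hf₁)
    calc 16 * 32 ^ D * deviation α n * f ≤ 16 * 32 ^ D * ((2 * D + 2) * f ^ (1 / c)) * f := by
          gcongr
      _ = 16 * 32 ^ D * (2 * D + 2) * f ^ (1 / c) * f := by ring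
      _ ≤ f ^ C₁ * f ^ (1 / c) * f := by gcongr
      _ = f ^ (C₁ + 1 / c + 1) := by
          rw [Real.rpow_add (by linarith), Real.rpow_add (by linarith), Real.rpow_one]
      _ ≤ f ^ C := hpow (by linarith)
  by_cases hd : Dense α n Δ f
  · refine (sparsifyRounds_triple_dense hα₀ hα₁ hmn (by linarith) hd hU).mono (fun _ hY => hY) ?_
    rintro Y ⟨F, hY, hF⟩
    exact ⟨F, hY, fun u hu => ⟨(hF u hu).1, (hF u hu).2.trans (hsize hd.1)⟩⟩
  · refine sparsifyRounds_triple_sparse hα₀ hα₁ hn hmn hd fun u hu => ?_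
    obtain ⟨h₁, h₂⟩ := hU u hu
    have hdegn : G.degree u < n := by simpa using G.degree_lt_card_verts u
    have hΔn := le_sq_of_degree hn hf hf₂ h₁ hdegn.le
    have hΔ : 0 < Δ := by
      rcases Nat.eq_zero_or_pos Δ with rfl | h
      · exfalso
        rw [Nat.cast_zero, Real.zero_rpow (by norm_num), zero_div] at hf₂
        linarith
      · exact h
    have hΔ' : (0 : ℝ) < Δ := by exact_mod_cast hΔ
    have hdeg : 0 < G.degree u := by
      have h₃ : (0 : ℝ) < Δ / f := by positivity
      exact_mod_cast h₃.trans_le h₁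
    refine ⟨hdeg, ?_⟩
    -- `Dense` can fail in three ways: `n = 2`, where degrees are at most 1; `n < n₀`, where they
    -- are below a constant; or a small `Δ`, which itself bounds them by `f ^ C`.
    rcases Nat.lt_or_ge n 3 with h3 | h3
    · have h₄ : G.degree u ≤ 1 := by omega
      have h₅ : (G.degree u : ℝ) ≤ 1 := by exact_mod_cast h₄
      exact h₅.trans (Real.one_le_rpow hf hCpos.le)
    by_cases hbig : 16 * 8 ^ depth α * deviation α n * f ≤ Δ
    · have h₄ : n < n₀ := by
        by_contra! hge
        exact hd ⟨h3, hbig, (hn₀ n hge).trans (le_prob_mul_slots hα₀ hα₁ hn hf hΔ hΔn)⟩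
      have h₅ : (G.degree u : ℝ) ≤ n₀ := by exact_mod_cast (by omega : G.degree u ≤ n₀)
      have h₆ : (0 : ℝ) ≤ 16 * 32 ^ D * (2 * D + 2) := by positivity
      calc (G.degree u : ℝ) ≤ K := by linarith
        _ ≤ f ^ C₁ := hC₁K n f h3 hf₁
        _ ≤ f ^ C := hpow (by linarith)
    · have h₄ : (G.degree u : ℝ) ≤ Δ := by exact_mod_cast h₂
      have h₅ := one_le_deviation (α := α) hn
      have h₆ : 16 * 8 ^ D * deviation α n * f ≤ 16 * 32 ^ D * deviation α n * f := by
        gcongr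
        norm_num
      have h₇ := hsize h3
      push Not at hbig
      linarith
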